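/- Let $M$ be a smooth 4-manifold with a symplectic form $\Omega$ and let $I\subset T^*M$ be a smooth subbundle of rank $2$ such that $D=I^\perp\subset TM$ is an Engel structure: the first derived system $I^{(1)}=\ker(\delta: I\to\Lambda^2(T^*M/I))$, $\delta\theta\equiv d\theta \bmod I$, is a subbundle of rank $1$, and $I^{(2)}=(I^{(1)})^{(1)}=0$. Assume that $(M,\Omega,D)$ is a Lagrangian Engel structure, i.e. that $\Omega|_D=0$. A (smooth) coframing $(\theta_1,\theta_2,\theta_3,\theta_4)$ on an open set $W\subset M$ is called $0$-adapted if on $W$ $$\Omega=\theta_1\wedge\theta_3+\theta_2\wedge\theta_4,\qquad I=\langle\theta_1,\theta_2\rangle,\qquad I^{(1)}=\langle\theta_1\rangle,$$ and $1$-adapted if moreover $d\theta_2\equiv\theta_3\wedge\theta_4 \bmod \theta_1,\theta_2$. For a $1$-adapted coframing define $p_3$ by $\theta_1\wedge d\theta_1\wedge\theta_4=\tfrac{p_3}{2}\,\Omega\wedge\Omega$. Let $U\subset M$ be the set of points $x$ such that $p_3(x)\neq0$ for some $1$-adapted coframing defined on a neighbourhood of $x$. Then $U$ is open, and there is a unique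 $0$-adapted coframing $\theta$ on $U$ satisfying $$d\theta_1=\theta_3\wedge\theta_2+(a\,\theta_3+b\,\theta_4)\wedge\theta_1,\qquad d\theta_2=(c\,\theta_2+e\,\theta_3+f\,\theta_4)\wedge\theta_1+\theta_3\wedge\theta_4$$ for some smooth functions $a,b,c,e,f$ on $U$. Uniqueness also holds locally: on every open $W\subset U$, each $0$-adapted coframing on $W$ satisfying equations of this form is the restriction of $\theta$. In particular $\theta$ is a canonical $e$-structure on $U$: if $\varphi:M\to M'$ is a diffeomorphism onto another such $(M',\Omega',I')$ with $\varphi^*\Omega'=\Omega$ and $\varphi^*I'=I$, and $U'$, $\theta'$ are the corresponding domain and coframing on $M'$, then $\varphi^{-1}(U')=U$ and $\varphi^*\theta'_i=\theta_i$ on $U$ for $i=1,\dots,4$. -/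

import Mathlib

open scoped Manifold ContDiff Topology

namespace LagrangianEngel

noncomputable section

/-! ### Exterior algebra of a topological vector space -/

section Pointwise

variable {V : Type*} [AddCommGroup V] [Module ℝ V] [TopologicalSpace V]

/-- The (not yet alternating) product `v ↦ α (v₁, …, v_k) * β (v_{k+1}, …, v_{k+l})`. -/
def tensorMul {k l : ℕ} (α : V [⋀^Fin k]→L[ℝ] ℝ) (β : V [⋀^Fin l]→L[ℝ] ℝ) :
    ContinuousMultilinearMap ℝ (fun _ : Fin (k + l) => V) ℝ where
  toMultilinearMap :=
    ((LinearMap.mul' ℝ ℝ).compMultilinearMap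
      (MultilinearMap.domCoprod α.toAlternatingMap.toMultilinearMap
        β.toAlternatingMap.toMultilinearMap)).domDomCongr finSumFinEquiv
  cont := by
    change Continuous fun v : Fin (k + l) → V =>
      α (fun i => v (Fin.castAdd l i)) * β (fun j => v (Fin.natAdd k j))
    exact (α.cont.comp (by fun_prop)).mul (β.cont.comp (by fun_prop))

/-- The wedge product of alternating forms, with the usual normalization
`(α ∧ β)(v) = 1 / (k! l!) ∑ σ, sign σ * α (v_{σ 1}, …, v_{σ k}) * β (v_{σ (k+1)}, …)`;
for covectors `(α ∧ β)(v, w) = α v * β w - α w * β v`. -/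
def wedge {k l : ℕ} (α : V [⋀^Fin k]→L[ℝ] ℝ) (β : V [⋀^Fin l]→L[ℝ] ℝ) :
    V [⋀^Fin (k + l)]→L[ℝ] ℝ :=
  ((k.factorial : ℝ) * (l.factorial : ℝ))⁻¹ •
    ContinuousMultilinearMap.alternatization (tensorMul α β)

/-- The degree-two part of the algebraic ideal generated by a space `J` of covectors:
`β ≡ 0 mod J` means `β ∈ idealTwo J`. -/
def idealTwo (J : Submodule ℝ (V [⋀^Fin 1]→L[ℝ] ℝ)) : Submodule ℝ (V [⋀^Fin 2]→L[ℝ] ℝ) :=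
  Submodule.span ℝ {β | ∃ θ ∈ J, ∃ η : V [⋀^Fin 1]→L[ℝ] ℝ, β = wedge θ η}

end Pointwise

/-! ### Differential forms on a 4-manifold -/

/-- The model space `ℝ⁴`. -/
abbrev E4 : Type := EuclideanSpace ℝ (Fin 4)

section Forms

variable {M : Type*} [TopologicalSpace M] [ChartedSpace E4 M]

variable (M) in
/-- Not necessarily smooth differential `k`-forms on `M`. -/
abbrev Form (k : ℕ) : Type _ := (x : M) → TangentSpace (𝓡 4) x [⋀^Fin k]→L[ℝ] ℝ

/-- The coordinate expression of a form in the preferred chart at `x₀`: its pullback under the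
inverse of the chart. -/
def Form.inChart {k : ℕ} (θ : Form M k) (x₀ : M) (y : E4) : E4 [⋀^Fin k]→L[ℝ] ℝ :=
  (θ ((extChartAt (𝓡 4) x₀).symm y)).compContinuousLinearMap
    (mfderiv (𝓡 4) (𝓡 4) (extChartAt (𝓡 4) x₀).symm y)

/-- Smoothness of a form at a point. -/
def Form.SmoothAt {k : ℕ} (θ : Form M k) (x : M) : Prop :=
  ContDiffAt ℝ ∞ (θ.inChart x) (extChartAt (𝓡 4) x x)

/-- The exterior derivative, computed at each point in the preferred chart there. -/
def Form.d {k : ℕ} (θ : Form M k) : Form M (k + 1) := fun x =>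
  (extDeriv (θ.inChart x) (extChartAt (𝓡 4) x x)).compContinuousLinearMap
    (mfderiv (𝓡 4) (𝓡 4) (extChartAt (𝓡 4) x) x)

theorem Form.inChart_add {k : ℕ} (θ η : Form M k) (x : M) :
    (θ + η).inChart x = θ.inChart x + η.inChart x := by
  ext y v; rfl

theorem Form.inChart_smul {k : ℕ} (c : ℝ) (θ : Form M k) (x : M) :
    (c • θ).inChart x = c • θ.inChart x := by
  ext y v; rfl

theorem Form.inChart_zero {k : ℕ} (x : M) : (0 : Form M k).inChart x = 0 := by
  ext y v; rfl

theorem Form.SmoothAt.add {k : ℕ} {θ η : Form M k} {x : M} (hθ : θ.SmoothAt x)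
    (hη : η.SmoothAt x) : (θ + η).SmoothAt x := by
  unfold Form.SmoothAt at *
  rw [Form.inChart_add]
  exact ContDiffAt.add hθ hη

theorem Form.SmoothAt.smul {k : ℕ} (c : ℝ) {θ : Form M k} {x : M} (hθ : θ.SmoothAt x) :
    (c • θ).SmoothAt x := by
  unfold Form.SmoothAt at *
  rw [Form.inChart_smul]
  exact ContDiffAt.const_smul c hθ

theorem Form.smoothAt_zero {k : ℕ} (x : M) : (0 : Form M k).SmoothAt x := by
  unfold Form.SmoothAt
  rw [Form.inChart_zero]
  exact contDiffAt_const

theorem Form.d_add {k : ℕ} {θ η : Form M k} {x : M} (hθ : θ.SmoothAt x) (hη : η.SmoothAt x) :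
    (θ + η).d x = θ.d x + η.d x := by
  unfold Form.d
  rw [Form.inChart_add, extDeriv_add (hθ.differentiableAt (by simp))
    (hη.differentiableAt (by simp))]
  rfl

theorem Form.d_smul {k : ℕ} (c : ℝ) (θ : Form M k) (x : M) : (c • θ).d x = c • θ.d x := by
  unfold Form.d
  rw [Form.inChart_smul, extDeriv_smul]
  rfl

theorem Form.d_zero {k : ℕ} (x : M) : (0 : Form M k).d x = 0 := by
  have h := Form.d_smul 0 (0 : Form M k) x
  rwa [zero_smul, zero_smul] at h

/-! ### Pfaffian systems, Engel structures, Lagrangian Engel structures -/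

variable (M) in
/-- A field of subspaces of the cotangent spaces. -/
abbrev CotangentField : Type _ :=
  (x : M) → Submodule ℝ (TangentSpace (𝓡 4) x [⋀^Fin 1]→L[ℝ] ℝ)

/-- `I` is a Pfaffian system of rank `r`: a smooth subbundle of rank `r` of the cotangent bundle. -/
def IsPfaffian (I : CotangentField M) (r : ℕ) : Prop :=
  ∀ x : M, ∃ θ : Fin r → Form M 1, ∀ᶠ y in 𝓝 x,
    (∀ i, (θ i).SmoothAt y) ∧ LinearIndependent ℝ (fun i => θ i y) ∧
      I y = Submodule.span ℝ (Set.range fun i => θ i y)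

/-- The first derived system `I⁽¹⁾ = ker (δ : I → Λ²(T*M / I))`, `δ θ ≡ dθ mod I`: at `x` it
consists of the values `θ x` of local smooth sections `θ` of `I` with `dθ ≡ 0 mod I` at `x`. -/
def derivedSystem (I : CotangentField M) : CotangentField M := fun x =>
  { carrier := {α | ∃ θ : Form M 1, (∀ᶠ y in 𝓝 x, θ.SmoothAt y ∧ θ y ∈ I y) ∧
      θ x = α ∧ θ.d x ∈ idealTwo (I x)}
    zero_mem' := ⟨0, Filter.Eventually.of_forall
      fun y => ⟨Form.smoothAt_zero y, (I y).zero_mem⟩, rfl, by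
        rw [Form.d_zero]; exact Submodule.zero_mem _⟩
    add_mem' := by
      rintro _ _ ⟨θ, hθ, rfl, hθ'⟩ ⟨η, hη, rfl, hη'⟩
      refine ⟨θ + η, ?_, rfl, ?_⟩
      · filter_upwards [hθ, hη] with y h₁ h₂
        exact ⟨h₁.1.add h₂.1, (I y).add_mem h₁.2 h₂.2⟩
      · rw [Form.d_add hθ.self_of_nhds.1 hη.self_of_nhds.1]
        exact Submodule.add_mem _ hθ' hη'
    smul_mem' := by
      rintro c _ ⟨θ, hθ, rfl, hθ'⟩
      refine ⟨c • θ, ?_, rfl, ?_⟩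
      · filter_upwards [hθ] with y h
        exact ⟨h.1.smul c, (I y).smul_mem c h.2⟩
      · rw [Form.d_smul]
        exact Submodule.smul_mem _ c hθ' }

/-- The annihilator `I^⊥ ⊆ TM`, as a field of sets of tangent vectors. -/
def annihilator (I : CotangentField M) (x : M) : Set (TangentSpace (𝓡 4) x) :=
  {v | ∀ θ ∈ I x, θ ![v] = 0}

/-- `D = I^⊥` is an Engel structure: `I`, `I⁽¹⁾`, `I⁽²⁾` are of rank `2`, `1`, `0`. -/
structure IsEngel (I : CotangentField M) : Prop where
  rank_two : IsPfaffian I 2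
  derived_rank_one : IsPfaffian (derivedSystem I) 1
  second_derived_eq_bot : ∀ x, derivedSystem (derivedSystem I) x = ⊥

/-- `Ω` is a symplectic form: a smooth, closed, non-degenerate 2-form. -/
structure IsSymplectic (Ω : Form M 2) : Prop where
  smooth : ∀ x, Ω.SmoothAt x
  closed : ∀ x, Ω.d x = 0
  nondegenerate : ∀ (x : M) (v : TangentSpace (𝓡 4) x), (∀ w, Ω x ![v, w] = 0) → v = 0

/-- `(M, Ω, D)`, `D = I^⊥`, is a Lagrangian Engel structure. (The planes of `D` have half the
dimension of `M`, so they are Lagrangian as soon as `Ω` vanishes on them.) -/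
structure IsLagrangianEngel (Ω : Form M 2) (I : CotangentField M) : Prop where
  symplectic : IsSymplectic Ω
  engel : IsEngel I
  lagrangian : ∀ x, ∀ v ∈ annihilator I x, ∀ w ∈ annihilator I x, Ω x ![v, w] = 0

/-! ### Adapted coframings

A coframing `θ = (θ₁, θ₂, θ₃, θ₄)` is indexed by `Fin 4`, so `θᵢ` is `θ (i - 1)`. Only the values
on the open set `U` matter. -/

/-- `θ` is a smooth coframing on `U`. -/
structure IsCoframing (U : Set M) (θ : Fin 4 → Form M 1) : Prop where
  smooth : ∀ x ∈ U, ∀ i, (θ i).SmoothAt x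
  linearIndependent : ∀ x ∈ U, LinearIndependent ℝ (fun i => θ i x)

/-- `θ` is a 0-adapted coframing on `U`: `Ω = θ₁ ∧ θ₃ + θ₂ ∧ θ₄`, `I = ⟨θ₁, θ₂⟩`,
`I⁽¹⁾ = ⟨θ₁⟩`. -/
structure IsZeroAdapted (Ω : Form M 2) (I : CotangentField M) (U : Set M)
    (θ : Fin 4 → Form M 1) : Prop where
  coframing : IsCoframing U θ
  symplectic_eq : ∀ x ∈ U, Ω x = wedge (θ 0 x) (θ 2 x) + wedge (θ 1 x) (θ 3 x)
  system_eq : ∀ x ∈ U, I x = Submodule.span ℝ {θ 0 x, θ 1 x}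
  derived_eq : ∀ x ∈ U, derivedSystem I x = Submodule.span ℝ {θ 0 x}

/-- `θ` is a 1-adapted coframing on `U`: 0-adapted with `dθ₂ ≡ θ₃ ∧ θ₄ mod θ₁, θ₂`. -/
structure IsOneAdapted (Ω : Form M 2) (I : CotangentField M) (U : Set M)
    (θ : Fin 4 → Form M 1) : Prop where
  zeroAdapted : IsZeroAdapted Ω I U θ
  d_eq : ∀ x ∈ U, (θ 1).d x - wedge (θ 2 x) (θ 3 x) ∈
    idealTwo (Submodule.span ℝ {θ 0 x, θ 1 x})

/-- `p` is the value at `x` of the relative invariant `p₃` of the 1-adapted coframing `θ`: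
`θ₁ ∧ dθ₁ ∧ θ₄ = (p / 2) Ω ∧ Ω` at `x`. -/
def IsPThree (Ω : Form M 2) (θ : Fin 4 → Form M 1) (x : M) (p : ℝ) : Prop :=
  wedge (wedge (θ 0 x) ((θ 0).d x)) (θ 3 x) = (p / 2) • wedge (Ω x) (Ω x)

/-- The domain where `p₃ ≠ 0`. (Under a change of 1-adapted coframing `p₃` is multiplied by a
nonvanishing function, so the choice of the local 1-adapted coframing is immaterial.) -/
def genericDomain (Ω : Form M 2) (I : CotangentField M) : Set M :=
  {x | ∃ (V : Set M) (θ : Fin 4 → Form M 1), IsOpen V ∧ x ∈ V ∧ IsOneAdapted Ω I V θ ∧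
    ∃ p : ℝ, p ≠ 0 ∧ IsPThree Ω θ x p}

/-- `θ` is a 0-adapted coframing on `U` with
`dθ₁ = θ₃ ∧ θ₂ + (a θ₃ + b θ₄) ∧ θ₁` and `dθ₂ = (c θ₂ + e θ₃ + f θ₄) ∧ θ₁ + θ₃ ∧ θ₄`
for some smooth functions `a, b, c, e, f` on `U`. -/
structure IsNormalized (Ω : Form M 2) (I : CotangentField M) (U : Set M)
    (θ : Fin 4 → Form M 1) : Prop where
  zeroAdapted : IsZeroAdapted Ω I U θ
  structure_eqs : ∃ a b c e f : M → ℝ,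
    (∀ g ∈ ({a, b, c, e, f} : Set (M → ℝ)), ContMDiffOn (𝓡 4) 𝓘(ℝ, ℝ) ∞ g U) ∧
    ∀ x ∈ U,
      (θ 0).d x = wedge (θ 2 x) (θ 1 x) + wedge (a x • θ 2 x + b x • θ 3 x) (θ 0 x) ∧
      (θ 1).d x = wedge (c x • θ 1 x + e x • θ 2 x + f x • θ 3 x) (θ 0 x) +
        wedge (θ 2 x) (θ 3 x)

end Forms

/-! ### Isomorphisms -/

section Isomorphisms

variable {M : Type*} [TopologicalSpace M] [ChartedSpace E4 M]
variable {N : Type*} [TopologicalSpace N] [ChartedSpace E4 N]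

/-- The pullback of a form under a map. -/
def Form.pullback {k : ℕ} (φ : M → N) (θ : Form N k) : Form M k := fun x =>
  (θ (φ x)).compContinuousLinearMap (mfderiv (𝓡 4) (𝓡 4) φ x)

/-- The diffeomorphism `φ` is an isomorphism from `(M, Ω, I)` to `(N, Ω', I')`:
`φ* Ω' = Ω` and `φ* I' = I`. -/
structure IsIsomorphism (φ : M ≃ₘ^∞⟮𝓡 4, 𝓡 4⟯ N) (Ω : Form M 2) (I : CotangentField M)
    (Ω' : Form N 2) (I' : CotangentField N) : Prop where
  pullback_symplectic : ∀ x, Ω'.pullback φ x = Ω x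
  pullback_system : ∀ x, I x = (I' (φ x)).map
    (ContinuousAlternatingMap.compContinuousLinearMapₗ (mfderiv (𝓡 4) (𝓡 4) φ x))

end Isomorphisms

end

end LagrangianEngel

open LagrangianEngel

/-! Let `X` be the frame dual to a 0-adapted coframing `θ`, both indexed from 0. The flag I⁽¹⁾ ⊂ I
allows only the changes θ 0 ↦ A θ 0, θ 1 ↦ C θ 0 + B θ 1, and Ω then determines the change of θ 2, θ
3 up to adding a combination of θ 0, θ 1 with symmetric matrix (s, t; t, u). So there are six
parameters, realized by `rescale` and `shear`.

The structure equations amount to seven values of dθ 0, dθ 1 on the dual frame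
(`IsNormalizedFrame`). One of them, dθ 0 (X 2, X 3) = 0, expresses that θ 0 lies in I⁽¹⁾
(`IsZeroAdapted.d_zero_apply`). The other six fix the six parameters. Derivatives of A, B, C enter
only through multiples of θ 0, θ 1, which the evaluations used for A, B, C do not see. The value dθ
0 (X 2, X 1) is p₃ and scales by A² B⁻¹, while dθ 1 (X 2, X 3) scales by A B². From a 1-adapted
coframing, making both equal to 1 means A = B⁻² and B⁵ = p₃, which has one real solution, smooth
where p₃ ≠ 0. Then dθ 0 (X 3, X 1) = 0 is linear in C with leading coefficient a multiple of p₃, and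
the last three equations are triangular in t, u, s.

Existence near a point follows this recipe (`IsOneAdapted.exists_isNormalized`). Uniqueness is the
same computation for two normalized coframings: it gives A⁵ = 1 and C = 0
(`StructureEqs.rescaling_eq_one`), then s = t = u = 0 (`StructureEqs.shear_eq_zero`). Uniqueness on
arbitrary open sets glues the local coframings, and, since d commutes with pullback, it also gives
invariance under isomorphisms. -/

namespace LagrangianEngel

noncomputable section


/-! ### Pullbacks, charts and the exterior derivative. -/

section Calculus

variable {M : Type*} [TopologicalSpace M] [ChartedSpace E4 M]
variable {N : Type*} [TopologicalSpace N] [ChartedSpace E4 N]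
variable {P : Type*} [TopologicalSpace P] [ChartedSpace E4 P]

theorem Form.pullback_congr {k : ℕ} {φ ψ : M → N} {x : M} (h : φ =ᶠ[𝓝 x] ψ) (θ : Form N k) :
    θ.pullback φ x = θ.pullback ψ x := by
  -- The values of `θ` at `φ x` and `ψ x` have different types; with derivatives read as
  -- endomorphisms of `E4`, the base point can be substituted.
  have key : ∀ (p q : N) (_ : p = q) (A : E4 →L[ℝ] E4),
      (θ p).compContinuousLinearMap A = (θ q).compContinuousLinearMap A := by
    rintro p _ rfl A; rfl
  have h2 := h.mfderiv_eq (I := 𝓡 4) (I' := 𝓡 4)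
  refine (key _ _ h.self_of_nhds _).trans ?_
  exact congrArg (fun A : E4 →L[ℝ] E4 => (θ (ψ x)).compContinuousLinearMap A) h2

theorem Form.pullback_comp {k : ℕ} {φ : M → N} {ψ : N → P} {x : M}
    (hψ : MDifferentiableAt (𝓡 4) (𝓡 4) ψ (φ x)) (hφ : MDifferentiableAt (𝓡 4) (𝓡 4) φ x)
    (θ : Form P k) : θ.pullback (ψ ∘ φ) x = (θ.pullback ψ).pullback φ x := by
  have h := mfderiv_comp x hψ hφ
  refine (congrArg (fun A : E4 →L[ℝ] E4 => (θ (ψ (φ x))).compContinuousLinearMap A) h).trans ?_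
  rfl

theorem Form.inChart_eq_pullback {k : ℕ} (θ : Form M k) (x : M) :
    θ.inChart x = θ.pullback (extChartAt (𝓡 4) x).symm := rfl

theorem Form.pullback_id {k : ℕ} (θ : Form M k) : θ.pullback id = θ := by
  funext x
  refine (congrArg (fun A : E4 →L[ℝ] E4 => (θ x).compContinuousLinearMap A)
    (mfderiv_id (I := 𝓡 4) (x := x))).trans ?_
  ext v; rfl

theorem Form.inChart_model {k : ℕ} (θ : Form E4 k) (x : E4) : θ.inChart x = θ := by
  rw [Form.inChart_eq_pullback]
  have : ((extChartAt (𝓡 4) x).symm : E4 → E4) = id := by simp [mfld_simps]; rfl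
  rw [this, Form.pullback_id]

theorem eventually_target (x : M) :
    ∀ᶠ y in 𝓝 (extChartAt (𝓡 4) x x), y ∈ (extChartAt (𝓡 4) x).target :=
  (isOpen_extChartAt_target x).mem_nhds (mem_extChartAt_target x)

theorem tendsto_extChartAt_symm (x : M) :
    Filter.Tendsto (extChartAt (𝓡 4) x).symm (𝓝 (extChartAt (𝓡 4) x x)) (𝓝 x) := by
  have := continuousAt_extChartAt_symm (I := 𝓡 4) x
  unfold ContinuousAt at this
  rwa [extChartAt_to_inv] at this

theorem contDiffAt_writtenInExtChartAt {φ : M → N} {x : M}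
    (hφ : ContMDiffAt (𝓡 4) (𝓡 4) ∞ φ x) :
    ContDiffAt ℝ ∞ (writtenInExtChartAt (𝓡 4) (𝓡 4) x φ) (extChartAt (𝓡 4) x x) := by
  have := (contMDiffAt_iff.1 hφ).2
  simpa [contDiffWithinAt_univ] using this

variable [IsManifold (𝓡 4) ∞ M] [IsManifold (𝓡 4) ∞ N]

theorem contMDiffAt_extChartAt_symm {x : M} {y : E4} (hy : y ∈ (extChartAt (𝓡 4) x).target) :
    ContMDiffAt (𝓡 4) (𝓡 4) ∞ (extChartAt (𝓡 4) x).symm y :=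
  (contMDiffOn_extChartAt_symm x).contMDiffAt ((isOpen_extChartAt_target x).mem_nhds hy)

theorem eventually_mdifferentiableAt {φ : M → N} {x : M}
    (hφ : ContMDiffAt (𝓡 4) (𝓡 4) ∞ φ x) :
    ∀ᶠ y in 𝓝 x, MDifferentiableAt (𝓡 4) (𝓡 4) φ y := by
  have h1 : ContMDiffAt (𝓡 4) (𝓡 4) 1 φ x := hφ.of_le (by simp)
  have : IsManifold (𝓡 4) 1 M := .of_le (n := ∞) (by simp)
  have : IsManifold (𝓡 4) 1 N := .of_le (n := ∞) (by simp)
  filter_upwards [(contMDiffAt_iff_contMDiffAt_nhds (by simp)).1 h1] with y hy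
  exact hy.mdifferentiableAt (by simp)

/-- The coordinate expression of a pullback. -/
theorem Form.inChart_pullback {k : ℕ} {φ : M → N} {x : M}
    (hφ : ContMDiffAt (𝓡 4) (𝓡 4) ∞ φ x) (θ : Form N k) :
    (θ.pullback φ).inChart x =ᶠ[𝓝 (extChartAt (𝓡 4) x x)] fun y =>
      (θ.inChart (φ x) (writtenInExtChartAt (𝓡 4) (𝓡 4) x φ y)).compContinuousLinearMap
        (fderiv ℝ (writtenInExtChartAt (𝓡 4) (𝓡 4) x φ) y) := by
  have hs := tendsto_extChartAt_symm x
  have h1 := hs.eventually (eventually_mdifferentiableAt hφ)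
  have h2 := hs.eventually (hφ.continuousAt.eventually
    ((isOpen_extChartAt_source (I := 𝓡 4) (φ x)).mem_nhds (mem_extChartAt_source (φ x))))
  have h3 := eventually_target x
  have hψ := contDiffAt_writtenInExtChartAt hφ
  have h4 : ∀ᶠ y in 𝓝 (extChartAt (𝓡 4) x x),
      DifferentiableAt ℝ (writtenInExtChartAt (𝓡 4) (𝓡 4) x φ) y := by
    filter_upwards [(hψ.of_le (m := 1) (by simp)).eventually (by simp)] with y hy
    exact hy.differentiableAt (by simp)
  filter_upwards [h1, h2.eventually_nhds, h3.eventually_nhds, h4] with y h1 h2 h3 h4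
  rw [Form.inChart_eq_pullback]
  have hy := (contMDiffAt_extChartAt_symm h3.self_of_nhds).mdifferentiableAt (by simp)
  rw [← Form.pullback_comp h1 hy]
  -- Both sides are the same map near `y`, as long as `φ` stays in the chart domain at `φ x`;
  -- functoriality of the pullback then does the rest.
  have e : φ ∘ (extChartAt (𝓡 4) x).symm =ᶠ[𝓝 y]
      (extChartAt (𝓡 4) (φ x)).symm ∘ writtenInExtChartAt (𝓡 4) (𝓡 4) x φ := by
    filter_upwards [h2] with z hz
    simp only [Function.comp, writtenInExtChartAt]
    exact ((extChartAt (𝓡 4) (φ x)).left_inv hz).symm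
  rw [Form.pullback_congr e, Form.pullback_comp]
  · unfold Form.pullback
    rw [mfderiv_eq_fderiv]
    rfl
  · refine (contMDiffAt_extChartAt_symm ?_).mdifferentiableAt (by simp)
    exact (extChartAt (𝓡 4) (φ x)).map_source h2.self_of_nhds
  · exact h4.mdifferentiableAt

theorem _root_.ContDiffAt.oneForm_apply {E : Type*} [NormedAddCommGroup E] [NormedSpace ℝ E]
    {F : Type*} [NormedAddCommGroup F] [NormedSpace ℝ F] {n : WithTop ℕ∞}
    {α : F → E [⋀^Fin 1]→L[ℝ] ℝ} {u : F → E} {y : F} (hα : ContDiffAt ℝ n α y)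
    (hu : ContDiffAt ℝ n u y) : ContDiffAt ℝ n (fun z => α z ![u z]) y := by
  have := ((ContinuousAlternatingMap.ofSubsingletonLIE (𝕜 := ℝ) (E := E) (F := ℝ)
    (0 : Fin 1)).symm.toContinuousLinearEquiv.contDiff.contDiffAt.comp y hα).clm_apply hu
  refine this.congr_of_eventuallyEq (Filter.Eventually.of_forall fun z => ?_)
  show α z ![u z] = α z _
  congr 1
  ext i
  fin_cases i
  rfl

/-- A family of covectors is smooth if all its evaluations are. -/
theorem contDiffAt_of_oneForm_apply {E : Type*} [NormedAddCommGroup E] [NormedSpace ℝ E]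
    [FiniteDimensional ℝ E] {F : Type*} [NormedAddCommGroup F] [NormedSpace ℝ F]
    {n : WithTop ℕ∞} {α : F → E [⋀^Fin 1]→L[ℝ] ℝ} {y : F}
    (h : ∀ v : E, ContDiffAt ℝ n (fun z => α z ![v]) y) : ContDiffAt ℝ n α y := by
  let b := Module.finBasis ℝ E
  have e : α = fun z => ∑ i, (α z ![b i]) •
      ContinuousAlternatingMap.ofSubsingleton ℝ E ℝ (0 : Fin 1)
        (LinearMap.toContinuousLinearMap (b.coord i)) := by
    funext z
    ext v
    have hv : v = ![v 0] := by ext i; fin_cases i; rfl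
    let T : E →L[ℝ] ℝ := (ContinuousAlternatingMap.ofSubsingleton ℝ E ℝ (0 : Fin 1)).symm (α z)
    have hT : ∀ w, α z ![w] = T w := fun w => by
      show α z ![w] = α z _
      congr 1
      ext i
      fin_cases i
      rfl
    have hs : T (v 0) = ∑ i, b.repr (v 0) i * T (b i) := by
      conv_lhs => rw [← b.sum_repr (v 0), map_sum]
      simp only [map_smul, smul_eq_mul]
    rw [hv, hT, hs]
    simp [hT, mul_comm]
  rw [e]
  exact ContDiffAt.sum fun i _ => (h (b i)).smul contDiffAt_const

theorem extDeriv_oneForm_apply {E : Type*} [NormedAddCommGroup E] [NormedSpace ℝ E]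
    (α : E → E [⋀^Fin 1]→L[ℝ] ℝ) (y u v : E) :
    extDeriv α y ![u, v] = fderiv ℝ α y u ![v] - fderiv ℝ α y v ![u] := by
  have h0 : Fin.removeNth 0 ![u, v] = ![v] := by ext i; fin_cases i; rfl
  have h1 : Fin.removeNth 1 ![u, v] = ![u] := by ext i; fin_cases i; rfl
  simp [extDeriv, ContinuousAlternatingMap.alternatizeUncurryFin_apply, Fin.sum_univ_two, h0, h1,
    sub_eq_add_neg]

theorem _root_.ContDiffAt.extDeriv_oneForm_apply {E : Type*} [NormedAddCommGroup E]
    [NormedSpace ℝ E] {α : E → E [⋀^Fin 1]→L[ℝ] ℝ} {u v : E → E} {y : E}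
    (hα : ContDiffAt ℝ ∞ α y) (hu : ContDiffAt ℝ ∞ u y) (hv : ContDiffAt ℝ ∞ v y) :
    ContDiffAt ℝ ∞ (fun z => extDeriv α z ![u z, v z]) y := by
  simp only [LagrangianEngel.extDeriv_oneForm_apply]
  have h := hα.fderiv_right (m := ∞) (by simp)
  exact ((h.clm_apply hu).oneForm_apply hv).sub ((h.clm_apply hv).oneForm_apply hu)

theorem Form.SmoothAt.pullback {φ : M → N} {x : M} (hφ : ContMDiffAt (𝓡 4) (𝓡 4) ∞ φ x)
    {θ : Form N 1} (hθ : θ.SmoothAt (φ x)) : (θ.pullback φ).SmoothAt x := by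
  have hψ := contDiffAt_writtenInExtChartAt hφ
  have hx : writtenInExtChartAt (𝓡 4) (𝓡 4) x φ (extChartAt (𝓡 4) x x) =
      extChartAt (𝓡 4) (φ x) (φ x) := by simp [writtenInExtChartAt]
  refine ContDiffAt.congr_of_eventuallyEq ?_ (Form.inChart_pullback hφ θ)
  refine contDiffAt_of_oneForm_apply fun v => ?_
  unfold Form.SmoothAt at hθ
  rw [← hx] at hθ
  have h1 : ContDiffAt ℝ ∞ (fun y => fderiv ℝ (writtenInExtChartAt (𝓡 4) (𝓡 4) x φ) y v)
      (extChartAt (𝓡 4) x x) := (hψ.fderiv_right (m := ∞) (by simp)).clm_apply contDiffAt_const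
  refine ((hθ.comp _ hψ).oneForm_apply h1).congr_of_eventuallyEq
    (Filter.Eventually.of_forall fun z => ?_)
  simp only [Function.comp, ContinuousAlternatingMap.compContinuousLinearMap_apply]
  congr 1
  ext i
  fin_cases i
  rfl

theorem Form.d_eq {k : ℕ} (θ : Form M k) (x : M) :
    θ.d x = extDeriv (θ.inChart x) (extChartAt (𝓡 4) x x) := by
  have : IsManifold (𝓡 4) 1 M := .of_le (n := ∞) (by simp)
  unfold Form.d
  rw [mfderiv_extChartAt_self]
  ext v
  rfl

/-- The exterior derivative commutes with pullbacks. -/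
theorem Form.d_pullback {k : ℕ} {φ : M → N} {x : M} (hφ : ContMDiffAt (𝓡 4) (𝓡 4) ∞ φ x)
    {θ : Form N k} (hθ : θ.SmoothAt (φ x)) : (θ.pullback φ).d x = θ.d.pullback φ x := by
  have hψ := contDiffAt_writtenInExtChartAt hφ
  have hx : writtenInExtChartAt (𝓡 4) (𝓡 4) x φ (extChartAt (𝓡 4) x x) =
      extChartAt (𝓡 4) (φ x) (φ x) := by simp [writtenInExtChartAt]
  have hm : mfderiv (𝓡 4) (𝓡 4) φ x =
      fderiv ℝ (writtenInExtChartAt (𝓡 4) (𝓡 4) x φ) (extChartAt (𝓡 4) x x) := by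
    rw [(hφ.mdifferentiableAt (by simp)).mfderiv]
    simp [fderivWithin_univ]
    rfl
  unfold Form.SmoothAt at hθ
  rw [← hx] at hθ
  rw [Form.d_eq, (Form.inChart_pullback hφ θ).extDeriv_eq,
    extDeriv_pullback (hθ.differentiableAt (by simp)) hψ (by simpa using WithTop.coe_le_coe.2 (le_top : (2 : ℕ∞) ≤ ⊤)), hx]
  have h := Form.d_eq θ (φ x)
  exact (congrArg₂ (fun (A : E4 →L[ℝ] E4) (β : E4 [⋀^Fin (k + 1)]→L[ℝ] ℝ) =>
    β.compContinuousLinearMap A) hm h).symm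

theorem Form.d_model {k : ℕ} (θ : Form E4 k) (y : E4) : θ.d y = extDeriv θ y := by
  rw [Form.d_eq, Form.inChart_model]
  simp [mfld_simps]
  rfl

/-- The exterior derivative may be computed in any one chart. -/
theorem Form.inChart_d {k : ℕ} {θ : Form M k} {x : M} (hθ : ∀ᶠ y in 𝓝 x, θ.SmoothAt y) :
    θ.d.inChart x =ᶠ[𝓝 (extChartAt (𝓡 4) x x)] extDeriv (θ.inChart x) := by
  filter_upwards [(tendsto_extChartAt_symm x).eventually hθ, eventually_target x] with y h1 h2
  -- The inverse chart is itself a smooth map out of the model space, where `Form.d` is `extDeriv`.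
  rw [Form.inChart_eq_pullback, ← Form.d_pullback (contMDiffAt_extChartAt_symm h2) h1,
    Form.d_model]
  rfl

end Calculus


/-! ### Explicit signed sums over permutations of at most four letters. -/

section Permutations

open Equiv

/-- A permutation is its value i at 0 together with a permutation of the remaining letters, and the
swap of 0 and i costs a sign unless i = 0. The summand depends on the underlying map only, so that
the formula for `n` can be substituted in the inner sum. -/
theorem sum_perm_fin_succ {n : ℕ} (F : (Fin (n + 1) → Fin (n + 1)) → ℝ) :
    ∑ σ : Perm (Fin (n + 1)), ((Perm.sign σ : ℤ) : ℝ) * F σ =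
      ∑ i : Fin (n + 1), (if i = 0 then 1 else -1) * ∑ e : Perm (Fin n),
        ((Perm.sign e : ℤ) : ℝ) * F (Fin.cons i fun j => swap 0 i (e j).succ) := by
  rw [Finset.univ_perm_fin_succ, Finset.sum_map, ← Finset.univ_product_univ, Finset.sum_product]
  refine Finset.sum_congr rfl fun i _ => ?_
  rw [Finset.mul_sum]
  refine Finset.sum_congr rfl fun e _ => ?_
  have h : (Perm.decomposeFin.symm (i, e) : Fin (n + 1) → Fin (n + 1)) =
      Fin.cons i fun j => swap 0 i (e j).succ := by
    funext j
    refine Fin.cases ?_ (fun j => ?_) j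
    · simp
    · simp [Perm.decomposeFin_symm_apply_succ]
  simp only [toEmbedding_apply, Perm.decomposeFin.symm_sign, h]
  split_ifs <;> simp

theorem sum_perm_two (f : Fin 2 → Fin 2 → ℝ) :
    ∑ σ : Perm (Fin 2), ((Perm.sign σ : ℤ) : ℝ) * f (σ 0) (σ 1) = f 0 1 - f 1 0 := by
  rw [sum_perm_fin_succ fun s => f (s 0) (s 1), Fin.sum_univ_two]
  simp only [Finset.univ_unique, Finset.sum_singleton, Perm.sign_one, Subsingleton.elim default (1 : Perm (Fin 1))]
  change 1 * (((1 : ℤ) : ℝ) * f 0 1) + (-1) * (((1 : ℤ) : ℝ) * f 1 0) = _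
  push_cast
  ring

theorem sum_perm_three (f : Fin 3 → Fin 3 → Fin 3 → ℝ) :
    ∑ σ : Perm (Fin 3), ((Perm.sign σ : ℤ) : ℝ) * f (σ 0) (σ 1) (σ 2) =
      f 0 1 2 - f 0 2 1 - f 1 0 2 + f 1 2 0 + f 2 0 1 - f 2 1 0 := by
  have h (i : Fin 3) := sum_perm_two fun p q => f i (swap 0 i p.succ) (swap 0 i q.succ)
  rw [sum_perm_fin_succ fun s => f (s 0) (s 1) (s 2), Fin.sum_univ_three]
  refine (congrArg₂ (· + ·) (congrArg₂ (· + ·) (congrArg (_ * ·) (h 0)) (congrArg (_ * ·) (h 1)))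
    (congrArg (_ * ·) (h 2))).trans ?_
  change 1 * (f 0 1 2 - f 0 2 1) + -1 * (f 1 0 2 - f 1 2 0) + -1 * (f 2 1 0 - f 2 0 1) = _
  ring

theorem sum_perm_four (f : Fin 4 → Fin 4 → Fin 4 → Fin 4 → ℝ) :
    ∑ σ : Perm (Fin 4), ((Perm.sign σ : ℤ) : ℝ) * f (σ 0) (σ 1) (σ 2) (σ 3) =
      (f 0 1 2 3 - f 0 1 3 2 - f 0 2 1 3 + f 0 2 3 1 + f 0 3 1 2 - f 0 3 2 1) -
      (f 1 0 2 3 - f 1 0 3 2 - f 1 2 0 3 + f 1 2 3 0 + f 1 3 0 2 - f 1 3 2 0) -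
      (f 2 1 0 3 - f 2 1 3 0 - f 2 0 1 3 + f 2 0 3 1 + f 2 3 1 0 - f 2 3 0 1) -
      (f 3 1 2 0 - f 3 1 0 2 - f 3 2 1 0 + f 3 2 0 1 + f 3 0 1 2 - f 3 0 2 1) := by
  have h (i : Fin 4) := sum_perm_three fun p q r =>
    f i (swap 0 i p.succ) (swap 0 i q.succ) (swap 0 i r.succ)
  rw [sum_perm_fin_succ fun s => f (s 0) (s 1) (s 2) (s 3), Fin.sum_univ_four]
  refine (congrArg₂ (· + ·) (congrArg₂ (· + ·) (congrArg₂ (· + ·) (congrArg (_ * ·) (h 0))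
    (congrArg (_ * ·) (h 1))) (congrArg (_ * ·) (h 2))) (congrArg (_ * ·) (h 3))).trans ?_
  change 1 * (f 0 1 2 3 - f 0 1 3 2 - f 0 2 1 3 + f 0 2 3 1 + f 0 3 1 2 - f 0 3 2 1) +
      -1 * (f 1 0 2 3 - f 1 0 3 2 - f 1 2 0 3 + f 1 2 3 0 + f 1 3 0 2 - f 1 3 2 0) +
      -1 * (f 2 1 0 3 - f 2 1 3 0 - f 2 0 1 3 + f 2 0 3 1 + f 2 3 1 0 - f 2 3 0 1) +
      -1 * (f 3 1 2 0 - f 3 1 0 2 - f 3 2 1 0 + f 3 2 0 1 + f 3 0 1 2 - f 3 0 2 1) = _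
  ring

end Permutations

/-! ### Multilinearity and explicit wedge products in low degree. -/

section Algebra

theorem vec_one {V : Type*} (f : Fin 1 → V) : f = ![f 0] := by ext i; fin_cases i; rfl

theorem vec_two {V : Type*} (f : Fin 2 → V) : f = ![f 0, f 1] := by ext i; fin_cases i <;> rfl

theorem vec_three {V : Type*} (f : Fin 3 → V) : f = ![f 0, f 1, f 2] := by ext i; fin_cases i <;> rfl

variable {V : Type*} [AddCommGroup V] [Module ℝ V] [TopologicalSpace V]
variable {W : Type*} [AddCommGroup W] [Module ℝ W] [TopologicalSpace W]

theorem oneForm_add (α : V [⋀^Fin 1]→L[ℝ] ℝ) (u v : V) : α ![u + v] = α ![u] + α ![v] :=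
  α.toContinuousMultilinearMap.cons_add ![] u v

theorem oneForm_smul (α : V [⋀^Fin 1]→L[ℝ] ℝ) (c : ℝ) (u : V) : α ![c • u] = c * α ![u] :=
  α.toContinuousMultilinearMap.cons_smul ![] c u

theorem oneForm_ext {α β : V [⋀^Fin 1]→L[ℝ] ℝ} (h : ∀ v, α ![v] = β ![v]) : α = β := by
  ext v
  have hv : v = ![v 0] := by ext i; fin_cases i; rfl
  rw [hv, h]

theorem twoForm_swap (β : V [⋀^Fin 2]→L[ℝ] ℝ) (u v : V) : β ![v, u] = -β ![u, v] := by
  have := β.map_swap ![u, v] (zero_ne_one (α := Fin 2))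
  refine Eq.trans (congrArg _ ?_) this
  ext i
  fin_cases i <;> rfl

theorem twoForm_self (β : V [⋀^Fin 2]→L[ℝ] ℝ) (u : V) : β ![u, u] = 0 := by
  linarith [twoForm_swap β u u]

theorem twoForm_add_left (β : V [⋀^Fin 2]→L[ℝ] ℝ) (u u' v : V) :
    β ![u + u', v] = β ![u, v] + β ![u', v] :=
  β.toContinuousMultilinearMap.cons_add ![v] u u'

theorem twoForm_smul_left (β : V [⋀^Fin 2]→L[ℝ] ℝ) (c : ℝ) (u v : V) :
    β ![c • u, v] = c * β ![u, v] :=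
  β.toContinuousMultilinearMap.cons_smul ![v] c u

theorem twoForm_sub_left (β : V [⋀^Fin 2]→L[ℝ] ℝ) (u u' v : V) :
    β ![u - u', v] = β ![u, v] - β ![u', v] := by
  have := twoForm_add_left β (u - u') u' v
  rw [sub_add_cancel] at this
  linarith

theorem twoForm_add_right (β : V [⋀^Fin 2]→L[ℝ] ℝ) (u v v' : V) :
    β ![u, v + v'] = β ![u, v] + β ![u, v'] := by
  rw [twoForm_swap, twoForm_add_left, twoForm_swap β u v, twoForm_swap β u v']
  ring

theorem twoForm_smul_right (β : V [⋀^Fin 2]→L[ℝ] ℝ) (c : ℝ) (u v : V) :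
    β ![u, c • v] = c * β ![u, v] := by
  rw [twoForm_swap, twoForm_smul_left, twoForm_swap β u v]
  ring

theorem twoForm_sub_right (β : V [⋀^Fin 2]→L[ℝ] ℝ) (u v v' : V) :
    β ![u, v - v'] = β ![u, v] - β ![u, v'] := by
  rw [twoForm_swap, twoForm_sub_left, twoForm_swap β u v, twoForm_swap β u v']
  ring

theorem twoForm_ext {α β : V [⋀^Fin 2]→L[ℝ] ℝ} (h : ∀ u v, α ![u, v] = β ![u, v]) :
    α = β := by
  ext v
  have hv : v = ![v 0, v 1] := by ext i; fin_cases i <;> rfl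
  rw [hv, h]

theorem wedge_apply {k l : ℕ} (α : V [⋀^Fin k]→L[ℝ] ℝ) (β : V [⋀^Fin l]→L[ℝ] ℝ)
    (v : Fin (k + l) → V) :
    wedge α β v = ((k.factorial : ℝ) * (l.factorial : ℝ))⁻¹ *
      ∑ σ : Equiv.Perm (Fin (k + l)), ((Equiv.Perm.sign σ : ℤ) : ℝ) *
        (α (fun i => v (σ (Fin.castAdd l i))) * β (fun j => v (σ (Fin.natAdd k j)))) := by
  unfold wedge
  rw [ContinuousAlternatingMap.smul_apply, ContinuousMultilinearMap.alternatization_apply_apply,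
    smul_eq_mul]
  congr 1
  refine Finset.sum_congr rfl fun σ _ => ?_
  rw [Units.smul_def, zsmul_eq_mul]
  rfl

theorem wedge_compContinuousLinearMap {k l : ℕ} (α : V [⋀^Fin k]→L[ℝ] ℝ)
    (β : V [⋀^Fin l]→L[ℝ] ℝ) (A : W →L[ℝ] V) :
    (wedge α β).compContinuousLinearMap A =
      wedge (α.compContinuousLinearMap A) (β.compContinuousLinearMap A) := by
  ext v
  rw [ContinuousAlternatingMap.compContinuousLinearMap_apply, wedge_apply, wedge_apply]
  rfl

theorem wedge_oneForm_apply (α β : V [⋀^Fin 1]→L[ℝ] ℝ) (u v : V) :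
    wedge α β ![u, v] = α ![u] * β ![v] - α ![v] * β ![u] := by
  rw [wedge_apply]
  have h := sum_perm_two fun p q => α ![![u, v] p] * β ![![u, v] q]
  refine Eq.trans (congrArg₂ (· * ·) rfl (Eq.trans (Finset.sum_congr rfl fun σ _ => ?_) h)) ?_
  · rw [vec_one fun i => _, vec_one fun j => _]
    rfl
  · simp

theorem wedge_one_two_apply (α : V [⋀^Fin 1]→L[ℝ] ℝ) (β : V [⋀^Fin 2]→L[ℝ] ℝ) (u v w : V) :
    wedge α β ![u, v, w] = α ![u] * β ![v, w] - α ![v] * β ![u, w] + α ![w] * β ![u, v] := by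
  rw [wedge_apply]
  have h := sum_perm_three fun p q r => α ![![u, v, w] p] * β ![![u, v, w] q, ![u, v, w] r]
  refine Eq.trans (congrArg₂ (· * ·) rfl (Eq.trans (Finset.sum_congr rfl fun σ _ => ?_) h)) ?_
  · rw [vec_one fun i => _, vec_two fun j => _]
    rfl
  · simp
    rw [twoForm_swap β v w, twoForm_swap β u w, twoForm_swap β u v]
    ring

theorem wedge_two_two_apply (α β : V [⋀^Fin 2]→L[ℝ] ℝ) (u v w z : V) :
    wedge α β ![u, v, w, z] = α ![u, v] * β ![w, z] - α ![u, w] * β ![v, z] +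
      α ![u, z] * β ![v, w] + α ![v, w] * β ![u, z] - α ![v, z] * β ![u, w] +
      α ![w, z] * β ![u, v] := by
  rw [wedge_apply]
  have h := sum_perm_four fun p q r s => α ![![u, v, w, z] p, ![u, v, w, z] q] *
    β ![![u, v, w, z] r, ![u, v, w, z] s]
  refine Eq.trans (congrArg₂ (· * ·) rfl (Eq.trans (Finset.sum_congr rfl fun σ _ => ?_) h)) ?_
  · rw [vec_two fun i => _, vec_two fun j => _]
    rfl
  · simp
    rw [twoForm_swap β v w, twoForm_swap β u w, twoForm_swap β u v, twoForm_swap β u z,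
      twoForm_swap β v z, twoForm_swap β w z, twoForm_swap α v w, twoForm_swap α u w,
      twoForm_swap α u v, twoForm_swap α u z, twoForm_swap α v z, twoForm_swap α w z]
    ring

theorem threeForm_swap_left (γ : V [⋀^Fin 3]→L[ℝ] ℝ) (u v w : V) :
    γ ![v, u, w] = -γ ![u, v, w] := by
  have := γ.map_swap ![u, v, w] (i := 0) (j := 1) (by decide)
  refine Eq.trans (congrArg _ ?_) this
  ext i
  fin_cases i <;> rfl

theorem threeForm_swap_right (γ : V [⋀^Fin 3]→L[ℝ] ℝ) (u v w : V) :
    γ ![u, w, v] = -γ ![u, v, w] := by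
  have := γ.map_swap ![u, v, w] (i := 1) (j := 2) (by decide)
  refine Eq.trans (congrArg _ ?_) this
  ext i
  fin_cases i <;> rfl

theorem wedge_three_one_apply (γ : V [⋀^Fin 3]→L[ℝ] ℝ) (β : V [⋀^Fin 1]→L[ℝ] ℝ) (u v w z : V) :
    wedge γ β ![u, v, w, z] = γ ![u, v, w] * β ![z] - γ ![u, v, z] * β ![w] +
      γ ![u, w, z] * β ![v] - γ ![v, w, z] * β ![u] := by
  rw [wedge_apply]
  have h := sum_perm_four fun p q r s =>
    γ ![![u, v, w, z] p, ![u, v, w, z] q, ![u, v, w, z] r] * β ![![u, v, w, z] s]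
  refine Eq.trans (congrArg₂ (· * ·) rfl (Eq.trans (Finset.sum_congr rfl fun σ _ => ?_) h)) ?_
  · rw [vec_three fun i => _, vec_one fun j => _]
    rfl
  · have h (a b c : V) : γ ![a, c, b] = - γ ![a, b, c] ∧ γ ![b, a, c] = - γ ![a, b, c] ∧
        γ ![b, c, a] = γ ![a, b, c] ∧ γ ![c, a, b] = γ ![a, b, c] ∧
        γ ![c, b, a] = - γ ![a, b, c] := by
      have h1 := threeForm_swap_right γ a b c
      have h2 := threeForm_swap_left γ a b c
      have h3 := threeForm_swap_right γ b a c
      have h4 := threeForm_swap_left γ a c b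
      have h5 := threeForm_swap_right γ c a b
      refine ⟨?_, ?_, ?_, ?_, ?_⟩ <;> linarith
    obtain ⟨a1, a2, a3, a4, a5⟩ := h u v w
    obtain ⟨b1, b2, b3, b4, b5⟩ := h u v z
    obtain ⟨c1, c2, c3, c4, c5⟩ := h u w z
    obtain ⟨d1, d2, d3, d4, d5⟩ := h v w z
    simp [Nat.factorial]
    rw [a1, a2, a3, a4, a5, b1, b2, b3, b4, b5, c1, c2, c3, c4, c5, d1, d2, d3, d4, d5]
    ring

end Algebra


/-! ### Dual frames and coefficients of forms. -/

section Frames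

variable {V : Type*} [AddCommGroup V] [Module ℝ V] [TopologicalSpace V]
variable {θ : Fin 4 → V [⋀^Fin 1]→L[ℝ] ℝ} {X : Fin 4 → V}

/-- `X` is the frame dual to the coframe `θ`. -/
structure IsDualFrame (θ : Fin 4 → V [⋀^Fin 1]→L[ℝ] ℝ) (X : Fin 4 → V) : Prop where
  apply : ∀ i j, θ i ![X j] = if i = j then 1 else 0
  expand : ∀ v, v = ∑ i, θ i ![v] • X i

/-- The values of a family of covectors, as a linear map. -/
def evalMap (θ : Fin 4 → V [⋀^Fin 1]→L[ℝ] ℝ) : V →ₗ[ℝ] (Fin 4 → ℝ) where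
  toFun v i := θ i ![v]
  map_add' u v := funext fun i => oneForm_add (θ i) u v
  map_smul' c v := funext fun i => oneForm_smul (θ i) c v

/-- A nonzero functional on ℝ⁴ vanishing on the range would be a nontrivial linear relation between
the θ i. -/
theorem evalMap_surjective (h : LinearIndependent ℝ θ) : Function.Surjective (evalMap θ) := by
  rw [← LinearMap.range_eq_top]
  by_contra hne
  obtain ⟨f, hf, hle⟩ := Submodule.exists_le_ker_of_lt_top _ (lt_top_iff_ne_top.2 hne)
  have hfe : ∀ w : Fin 4 → ℝ, f w = ∑ i, w i * f (Pi.single i 1) := fun w => by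
    conv_lhs => rw [pi_eq_sum_univ' w, map_sum]
    refine Finset.sum_congr rfl fun i _ => ?_
    rw [map_smul, smul_eq_mul]
  have hz : ∑ i, f (Pi.single i 1) • θ i = 0 := by
    refine oneForm_ext fun v => ?_
    have h1 : f (evalMap θ v) = 0 := hle ⟨v, rfl⟩
    rw [hfe] at h1
    simpa [evalMap, mul_comm] using h1
  have h0 := Fintype.linearIndependent_iff.1 h _ hz
  exact hf (LinearMap.ext fun w => by rw [hfe]; simp [h0])

/-- In dimension 4 the evaluation map is surjective, hence injective, and a vector has the same
evaluations as its expansion. -/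
theorem IsDualFrame.of_apply (hV : Module.finrank ℝ V = 4)
    (h : ∀ i j, θ i ![X j] = if i = j then 1 else 0) : IsDualFrame θ X := by
  have : FiniteDimensional ℝ V := .of_finrank_pos (by omega)
  have hs : Function.Surjective (evalMap θ) := fun w => ⟨∑ j, w j • X j, by
    funext i
    have : evalMap θ (∑ j, w j • X j) i = ∑ j, w j * θ i ![X j] := by
      simp only [map_sum, map_smul, Finset.sum_apply, Pi.smul_apply, smul_eq_mul]
      rfl
    rw [this]
    simp [h]⟩
  have hi : Function.Injective (evalMap θ) :=
    (LinearMap.injective_iff_surjective_of_finrank_eq_finrank (by simp [hV])).2 hs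
  refine ⟨h, fun v => hi ?_⟩
  funext i
  have : evalMap θ (∑ j, θ j ![v] • X j) i = ∑ j, θ j ![v] * θ i ![X j] := by
    simp only [map_sum, map_smul, Finset.sum_apply, Pi.smul_apply, smul_eq_mul]
    rfl
  rw [this]
  simp [h, evalMap]

theorem exists_isDualFrame (hV : Module.finrank ℝ V = 4) (h : LinearIndependent ℝ θ) :
    ∃ X, IsDualFrame θ X := by
  choose X hX using fun j : Fin 4 => evalMap_surjective h (Pi.single j 1)
  refine ⟨X, .of_apply hV fun i j => ?_⟩
  have := congrFun (hX j) i
  simpa [evalMap, Pi.single_apply] using this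

theorem IsDualFrame.linearIndependent (h : IsDualFrame θ X) : LinearIndependent ℝ θ := by
  refine Fintype.linearIndependent_iff.2 fun g hg i => ?_
  have := congrArg (fun α : V [⋀^Fin 1]→L[ℝ] ℝ => α ![X i]) hg
  simpa [h.apply] using this

theorem IsDualFrame.unique (h : IsDualFrame θ X) {Y : Fin 4 → V} (h' : IsDualFrame θ Y) :
    Y = X := by
  funext j
  rw [h.expand (Y j)]
  simp [h'.apply]

theorem IsDualFrame.oneForm_expand (h : IsDualFrame θ X) (η : V [⋀^Fin 1]→L[ℝ] ℝ) :
    η = ∑ i, η ![X i] • θ i := by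
  refine oneForm_ext fun v => ?_
  conv_lhs => rw [h.expand v]
  simp only [Fin.sum_univ_four, oneForm_add, oneForm_smul, ContinuousAlternatingMap.add_apply,
    ContinuousAlternatingMap.smul_apply, smul_eq_mul]
  ring

theorem IsDualFrame.oneForm_ext (h : IsDualFrame θ X) {η ξ : V [⋀^Fin 1]→L[ℝ] ℝ}
    (hηξ : ∀ i, η ![X i] = ξ ![X i]) : η = ξ := by
  rw [h.oneForm_expand η, h.oneForm_expand ξ]
  simp [hηξ]

theorem IsDualFrame.twoForm_ext (h : IsDualFrame θ X) {β γ : V [⋀^Fin 2]→L[ℝ] ℝ}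
    (h01 : β ![X 0, X 1] = γ ![X 0, X 1]) (h02 : β ![X 0, X 2] = γ ![X 0, X 2])
    (h03 : β ![X 0, X 3] = γ ![X 0, X 3]) (h12 : β ![X 1, X 2] = γ ![X 1, X 2])
    (h13 : β ![X 1, X 3] = γ ![X 1, X 3]) (h23 : β ![X 2, X 3] = γ ![X 2, X 3]) : β = γ := by
  have h (α : V [⋀^Fin 2]→L[ℝ] ℝ) (u v : V) := calc
    α ![u, v] = α ![∑ i, θ i ![u] • X i, ∑ i, θ i ![v] • X i] := by rw [← h.expand, ← h.expand]
    _ = (θ 0 ![u] * θ 1 ![v] - θ 1 ![u] * θ 0 ![v]) * α ![X 0, X 1] +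
        (θ 0 ![u] * θ 2 ![v] - θ 2 ![u] * θ 0 ![v]) * α ![X 0, X 2] +
        (θ 0 ![u] * θ 3 ![v] - θ 3 ![u] * θ 0 ![v]) * α ![X 0, X 3] +
        (θ 1 ![u] * θ 2 ![v] - θ 2 ![u] * θ 1 ![v]) * α ![X 1, X 2] +
        (θ 1 ![u] * θ 3 ![v] - θ 3 ![u] * θ 1 ![v]) * α ![X 1, X 3] +
        (θ 2 ![u] * θ 3 ![v] - θ 3 ![u] * θ 2 ![v]) * α ![X 2, X 3] := by
      simp only [Fin.sum_univ_four, twoForm_add_left, twoForm_add_right, twoForm_smul_left,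
        twoForm_smul_right, twoForm_self, twoForm_swap α (X 0) (X 1), twoForm_swap α (X 0) (X 2),
        twoForm_swap α (X 0) (X 3), twoForm_swap α (X 1) (X 2), twoForm_swap α (X 1) (X 3),
        twoForm_swap α (X 2) (X 3)]
      ring
  refine LagrangianEngel.twoForm_ext fun u v => ?_
  rw [h, h γ, h01, h02, h03, h12, h13, h23]

theorem IsDualFrame.fourForm_ext (h : IsDualFrame θ X) {β γ : V [⋀^Fin 4]→L[ℝ] ℝ}
    (hβγ : β ![X 0, X 1, X 2, X 3] = γ ![X 0, X 1, X 2, X 3]) : β = γ := by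
  have hX : (![X 0, X 1, X 2, X 3] : Fin 4 → V) = X := by ext i; fin_cases i <;> rfl
  rw [hX] at hβγ
  have li : LinearIndependent ℝ X := by
    refine Fintype.linearIndependent_iff.2 fun g hg i => ?_
    have : evalMap θ (∑ j, g j • X j) i = ∑ j, g j * θ i ![X j] := by
      simp only [map_sum, map_smul, Finset.sum_apply, Pi.smul_apply, smul_eq_mul]
      rfl
    rw [hg] at this
    simpa [h.apply] using this.symm
  have sp : ⊤ ≤ Submodule.span ℝ (Set.range X) := fun v _ => by
    rw [h.expand v]
    exact Submodule.sum_mem _ fun i _ =>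
      Submodule.smul_mem _ _ (Submodule.subset_span (Set.mem_range_self i))
  have key : β.toAlternatingMap = γ.toAlternatingMap := by
    rw [β.toAlternatingMap.eq_smul_basis_det (Module.Basis.mk li sp),
      γ.toAlternatingMap.eq_smul_basis_det (Module.Basis.mk li sp), Module.Basis.coe_mk]
    exact congrArg (· • (Module.Basis.mk li sp).det) hβγ
  exact ContinuousAlternatingMap.toAlternatingMap_injective key

theorem IsDualFrame.mem_span_singleton_iff (h : IsDualFrame θ X) {η : V [⋀^Fin 1]→L[ℝ] ℝ} :
    η ∈ Submodule.span ℝ {θ 0} ↔ η ![X 1] = 0 ∧ η ![X 2] = 0 ∧ η ![X 3] = 0 := by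
  rw [Submodule.mem_span_singleton]
  constructor
  · rintro ⟨a, rfl⟩
    simp [h.apply]
  · rintro ⟨h1, h2, h3⟩
    refine ⟨η ![X 0], ?_⟩
    conv_rhs => rw [h.oneForm_expand η]
    simp [Fin.sum_univ_four, h1, h2, h3]

theorem IsDualFrame.mem_span_pair_iff (h : IsDualFrame θ X) {η : V [⋀^Fin 1]→L[ℝ] ℝ} :
    η ∈ Submodule.span ℝ {θ 0, θ 1} ↔ η ![X 2] = 0 ∧ η ![X 3] = 0 := by
  rw [Submodule.mem_span_pair]
  constructor
  · rintro ⟨a, b, rfl⟩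
    simp [h.apply]
  · rintro ⟨h2, h3⟩
    refine ⟨η ![X 0], η ![X 1], ?_⟩
    conv_rhs => rw [h.oneForm_expand η]
    simp [Fin.sum_univ_four, h2, h3]

/-- Of the six basis products only θ 2 ∧ θ 3 has no factor θ 0 or θ 1. -/
theorem IsDualFrame.mem_idealTwo_iff (h : IsDualFrame θ X) {β : V [⋀^Fin 2]→L[ℝ] ℝ} :
    β ∈ idealTwo (Submodule.span ℝ {θ 0, θ 1}) ↔ β ![X 2, X 3] = 0 := by
  constructor
  · intro hβ
    refine Submodule.span_induction (p := fun β _ => β ![X 2, X 3] = 0) ?_ ?_ ?_ ?_ hβ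
    · rintro _ ⟨α, hα, η, rfl⟩
      obtain ⟨h2, h3⟩ := h.mem_span_pair_iff.1 hα
      rw [wedge_oneForm_apply, h2, h3]
      ring
    · rfl
    · intro α γ _ _ hα hγ
      rw [ContinuousAlternatingMap.add_apply, hα, hγ, add_zero]
    · intro c α _ hα
      rw [ContinuousAlternatingMap.smul_apply, hα, smul_zero]
  · intro h23
    have e : β = wedge (θ 0) (β ![X 0, X 1] • θ 1 + β ![X 0, X 2] • θ 2 + β ![X 0, X 3] • θ 3) +
        wedge (θ 1) (β ![X 1, X 2] • θ 2 + β ![X 1, X 3] • θ 3) := by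
      apply h.twoForm_ext <;>
      simp [wedge_oneForm_apply, h.apply, h23]
    rw [e]
    refine Submodule.add_mem _ (Submodule.subset_span ⟨_, Submodule.subset_span ?_, _, rfl⟩)
      (Submodule.subset_span ⟨_, Submodule.subset_span ?_, _, rfl⟩) <;> simp

/-- Turns p₃ into a coefficient of dθ 0. A 4-form is determined by its value on the frame, so one
evaluation suffices; reordering θ 0 ∧ θ 2 ∧ θ 1 ∧ θ 3 gives Ω ∧ Ω the value -2, whence the order `X
2, X 1`. -/
theorem IsDualFrame.isPThree_iff (h : IsDualFrame θ X) {β Ω : V [⋀^Fin 2]→L[ℝ] ℝ}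
    (hΩ : Ω = wedge (θ 0) (θ 2) + wedge (θ 1) (θ 3)) {p : ℝ} :
    wedge (wedge (θ 0) β) (θ 3) = (p / 2) • wedge Ω Ω ↔ p = β ![X 2, X 1] := by
  have h1 : wedge (wedge (θ 0) β) (θ 3) ![X 0, X 1, X 2, X 3] = β ![X 1, X 2] := by
    have := wedge_three_one_apply (wedge (θ 0) β) (θ 3) (X 0) (X 1) (X 2) (X 3)
    refine this.trans ?_
    have e := wedge_one_two_apply (θ 0) β (X 0) (X 1) (X 2)
    simp only [Nat.reduceAdd] at e
    simp [h.apply, e]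
  have h2 : wedge Ω Ω ![X 0, X 1, X 2, X 3] = -2 := by
    refine (wedge_two_two_apply Ω Ω (X 0) (X 1) (X 2) (X 3)).trans ?_
    simp [hΩ, wedge_oneForm_apply, h.apply]
    norm_num
  rw [twoForm_swap β (X 1)]
  constructor
  · intro e
    have := congrArg (fun γ : V [⋀^Fin 4]→L[ℝ] ℝ => γ ![X 0, X 1, X 2, X 3]) e
    have e2 : β ![X 1, X 2] = p / 2 * -2 :=
      h1.symm.trans (this.trans (congrArg (p / 2 * ·) h2))
    linarith
  · intro e
    have e2 : β ![X 1, X 2] = p / 2 * -2 := by linarith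
    exact h.fourForm_ext (h1.trans (e2.trans (congrArg (p / 2 * ·) h2).symm))

end Frames


/-! ### The group of changes of 0-adapted coframes and its normalization. -/

section ChangeOfCoframe

variable {V : Type*} [AddCommGroup V] [Module ℝ V] [TopologicalSpace V]
variable {θ θ' : Fin 4 → V [⋀^Fin 1]→L[ℝ] ℝ} {X : Fin 4 → V} {A B C s t u : ℝ}

/-- The structure equations of a normalized coframing `θ` with `dθ₁ = β₁`, `dθ₂ = β₂`. -/
def StructureEqs (θ : Fin 4 → V [⋀^Fin 1]→L[ℝ] ℝ) (β₁ β₂ : V [⋀^Fin 2]→L[ℝ] ℝ)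
    (a b c e f : ℝ) : Prop :=
  β₁ = wedge (θ 2) (θ 1) + wedge (a • θ 2 + b • θ 3) (θ 0) ∧
    β₂ = wedge (c • θ 1 + e • θ 2 + f • θ 3) (θ 0) + wedge (θ 2) (θ 3)

/-- The structure equations of a normalized coframing, in terms of the dual frame. -/
structure IsNormalizedFrame (X : Fin 4 → V) (β₁ β₂ : V [⋀^Fin 2]→L[ℝ] ℝ) : Prop where
  one_two_one : β₁ ![X 2, X 1] = 1
  one_three_one : β₁ ![X 3, X 1] = 0
  one_two_three : β₁ ![X 2, X 3] = 0
  one_one_zero : β₁ ![X 1, X 0] = 0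
  two_two_three : β₂ ![X 2, X 3] = 1
  two_two_one : β₂ ![X 2, X 1] = 0
  two_three_one : β₂ ![X 3, X 1] = 0

/-- Of the twelve coefficients of the two forms, seven are prescribed; the five free ones are the
structure functions. -/
theorem IsNormalizedFrame.structureEqs {β₁ β₂ : V [⋀^Fin 2]→L[ℝ] ℝ} (h : IsDualFrame θ X)
    (hX : IsNormalizedFrame X β₁ β₂) :
    StructureEqs θ β₁ β₂ (β₁ ![X 2, X 0]) (β₁ ![X 3, X 0]) (β₂ ![X 1, X 0]) (β₂ ![X 2, X 0])
      (β₂ ![X 3, X 0]) := by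
  obtain ⟨h1, h2, h3, h4, h5, h6, h7⟩ := hX
  rw [twoForm_swap] at h1 h2 h4 h6 h7
  rw [neg_eq_iff_eq_neg] at h1 h2 h4 h6 h7
  constructor <;> apply h.twoForm_ext <;>
  simp [wedge_oneForm_apply, h.apply, h1, h2, h3, h4, h5, h6, h7, twoForm_swap β₁ (X 0),
    twoForm_swap β₂ (X 0)]

theorem StructureEqs.isNormalizedFrame {β₁ β₂ : V [⋀^Fin 2]→L[ℝ] ℝ} {a b c e f : ℝ}
    (h : IsDualFrame θ X) (hs : StructureEqs θ β₁ β₂ a b c e f) :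
    IsNormalizedFrame X β₁ β₂ := by
  obtain ⟨h1, h2⟩ := hs
  constructor <;> simp [h1, h2, wedge_oneForm_apply, h.apply]

/-- Equality of the two expressions of Ω makes the blocks of θ' 2, θ' 3 inverse to those of θ' 0, θ'
1, and the structure equations then leave C = 0, B = A² and A B² = 1. Hence A⁵ = 1, and A = 1
because A is real. The assumptions on β₁', β₂' are only those values in which derivatives of A, B, C
do not occur. -/
theorem StructureEqs.rescaling_eq_one {β₁ β₂ β₁' β₂' : V [⋀^Fin 2]→L[ℝ] ℝ} {a b c e f : ℝ}
    (h : IsDualFrame θ X) (hX : IsNormalizedFrame X β₁ β₂)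
    (hθ' : StructureEqs θ' β₁' β₂' a b c e f)
    (hΩ : wedge (θ' 0) (θ' 2) + wedge (θ' 1) (θ' 3) = wedge (θ 0) (θ 2) + wedge (θ 1) (θ 3))
    (h0 : θ' 0 = A • θ 0) (h1 : θ' 1 = C • θ 0 + B • θ 1)
    (hβ21 : β₁' ![X 2, X 1] = A * β₁ ![X 2, X 1]) (hβ31 : β₁' ![X 3, X 1] = A * β₁ ![X 3, X 1])
    (hβ23 : β₂' ![X 2, X 3] = B * β₂ ![X 2, X 3] + C * β₁ ![X 2, X 3]) :
    θ' 0 = θ 0 ∧ θ' 1 = θ 1 := by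
  have w (i j : Fin 4) := congrArg (fun γ : V [⋀^Fin 2]→L[ℝ] ℝ => γ ![X i, X j]) hΩ
  have w02 := w 0 2
  have w03 := w 0 3
  have w12 := w 1 2
  have w13 := w 1 3
  simp [wedge_oneForm_apply, h0, h1, h.apply] at w02 w03 w12 w13
  rw [hX.one_two_one, hθ'.1] at hβ21
  rw [hX.one_three_one, hθ'.1] at hβ31
  rw [hX.two_two_three, hX.one_two_three, hθ'.2] at hβ23
  simp [wedge_oneForm_apply, h0, h1, h.apply] at hβ21 hβ31 hβ23
  have hB : B ≠ 0 := fun hB => by simp [hB] at w13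
  have h32 : θ' 3 ![X 2] = 0 := by tauto
  rw [h32] at w02 hβ23
  have hA : A ≠ 0 := fun hA => by simp [hA] at w02
  -- From the vanishing of dθ' 0 on (X 3, X 1), which is B times this value.
  have h23 : θ' 2 ![X 3] = 0 := by tauto
  rw [h23] at w03
  have h33 : θ' 3 ![X 3] ≠ 0 := fun h33 => by simp [h33] at w13
  have hC : C = 0 := by
    have : C * θ' 3 ![X 3] = 0 := by linarith
    exact (mul_eq_zero.1 this).resolve_right h33
  have m33 : θ' 3 ![X 3] = B⁻¹ := eq_inv_of_mul_eq_one_right w13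
  have m22 : θ' 2 ![X 2] = A⁻¹ := eq_inv_of_mul_eq_one_right (by linarith)
  rw [m22] at hβ21 hβ23
  rw [m33] at hβ23
  field_simp at hβ21 hβ23
  have e1 : B = A ^ 2 := by linarith
  have e2 : A * B ^ 2 = 1 := by linarith
  have e3 : A ^ 5 = 1 := by rw [e1] at e2; linarith
  have e4 : A = 1 := by
    have hp : 0 ≤ A := by
      by_contra hn
      have : A ^ 5 < 0 := Odd.pow_neg (by decide) (not_le.1 hn)
      linarith
    exact (pow_eq_one_iff_of_nonneg hp (by norm_num)).1 e3
  subst e4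
  rw [h0, h1, hC, e1]
  simp

/-- Ω leaves only a symmetric shear (s, t, u). The two conditions on β₂ give u = 0 and t = 0; in the
condition on β₁ the unknown coefficients a, b are multiplied by t, u, so it gives s = 0. -/
theorem StructureEqs.shear_eq_zero {β₁ β₂ : V [⋀^Fin 2]→L[ℝ] ℝ} {a b c e f : ℝ}
    (h : IsDualFrame θ X) (hX : IsNormalizedFrame X β₁ β₂)
    (hθ' : StructureEqs θ' β₁ β₂ a b c e f)
    (hΩ : wedge (θ' 0) (θ' 2) + wedge (θ' 1) (θ' 3) = wedge (θ 0) (θ 2) + wedge (θ 1) (θ 3))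
    (h0 : θ' 0 = θ 0) (h1 : θ' 1 = θ 1) : θ' = θ := by
  have w (i j : Fin 4) := congrArg (fun γ : V [⋀^Fin 2]→L[ℝ] ℝ => γ ![X i, X j]) hΩ
  have w01 := w 0 1
  have w02 := w 0 2
  have w03 := w 0 3
  have w12 := w 1 2
  have w13 := w 1 3
  simp [wedge_oneForm_apply, h0, h1, h.apply] at w01 w02 w03 w12 w13
  have r1 := hX.two_two_one
  have r2 := hX.two_three_one
  have r3 := hX.one_one_zero
  rw [hθ'.2] at r1 r2
  rw [hθ'.1] at r3
  simp [wedge_oneForm_apply, h0, h1, h.apply, w02, w03, w12, w13] at r1 r2 r3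
  rw [r2] at w01
  have w30 : θ' 3 ![X 0] = 0 := by linarith
  have r3' : θ' 2 ![X 0] = 0 := by rw [r2, r1] at r3; linarith
  funext i
  fin_cases i
  · exact h0
  · exact h1
  · refine h.oneForm_ext fun j => ?_
    fin_cases j <;> simp [h.apply, *]
  · refine h.oneForm_ext fun j => ?_
    fin_cases j <;> simp [h.apply, *]

/-- The change of coframe which preserves `θ₁ ∧ θ₃ + θ₂ ∧ θ₄` and acts on `θ₁, θ₂` by a lower
triangular matrix. -/
def rescale (A B C : ℝ) (θ : Fin 4 → V [⋀^Fin 1]→L[ℝ] ℝ) : Fin 4 → V [⋀^Fin 1]→L[ℝ] ℝ :=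
  ![A • θ 0, C • θ 0 + B • θ 1, A⁻¹ • θ 2 - (C * A⁻¹ * B⁻¹) • θ 3, B⁻¹ • θ 3]

/-- The frame dual to `rescale A B C θ`. -/
def rescaleFrame (A B C : ℝ) (X : Fin 4 → V) : Fin 4 → V :=
  ![A⁻¹ • X 0 - (C * A⁻¹ * B⁻¹) • X 1, B⁻¹ • X 1, A • X 2, B • X 3 + C • X 2]

/-- The change of coframe which preserves `θ₁ ∧ θ₃ + θ₂ ∧ θ₄` and fixes `θ₁, θ₂`. -/
def shear (s t u : ℝ) (θ : Fin 4 → V [⋀^Fin 1]→L[ℝ] ℝ) : Fin 4 → V [⋀^Fin 1]→L[ℝ] ℝ :=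
  ![θ 0, θ 1, θ 2 + s • θ 0 + t • θ 1, θ 3 + t • θ 0 + u • θ 1]

/-- The frame dual to `shear s t u θ`. -/
def shearFrame (s t u : ℝ) (X : Fin 4 → V) : Fin 4 → V :=
  ![X 0 - s • X 2 - t • X 3, X 1 - t • X 2 - u • X 3, X 2, X 3]

theorem IsDualFrame.rescale (hV : Module.finrank ℝ V = 4) (h : IsDualFrame θ X) (hA : A ≠ 0)
    (hB : B ≠ 0) : IsDualFrame (rescale A B C θ) (rescaleFrame A B C X) := by
  refine .of_apply hV fun i j => ?_
  fin_cases i <;> fin_cases j <;>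
    simp [LagrangianEngel.rescale, rescaleFrame, oneForm_add, oneForm_smul, h.apply,
      hA, hB] <;> field_simp <;> ring

theorem IsDualFrame.shear (hV : Module.finrank ℝ V = 4) (h : IsDualFrame θ X) :
    IsDualFrame (shear s t u θ) (shearFrame s t u X) := by
  refine .of_apply hV fun i j => ?_
  fin_cases i <;> fin_cases j <;>
    simp [LagrangianEngel.shear, shearFrame, oneForm_smul, h.apply]

theorem wedge_rescale (hA : A ≠ 0) (hB : B ≠ 0) :
    wedge (rescale A B C θ 0) (rescale A B C θ 2) + wedge (rescale A B C θ 1) (rescale A B C θ 3) =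
      wedge (θ 0) (θ 2) + wedge (θ 1) (θ 3) := by
  refine twoForm_ext fun v w => ?_
  simp [wedge_oneForm_apply, rescale]
  field_simp
  ring

theorem wedge_shear :
    wedge (shear s t u θ 0) (shear s t u θ 2) + wedge (shear s t u θ 1) (shear s t u θ 3) =
      wedge (θ 0) (θ 2) + wedge (θ 1) (θ 3) := by
  refine twoForm_ext fun v w => ?_
  simp [wedge_oneForm_apply, shear]
  ring

theorem span_pair_rescale (hA : A ≠ 0) (hB : B ≠ 0) :
    Submodule.span ℝ {rescale A B C θ 0, rescale A B C θ 1} = Submodule.span ℝ {θ 0, θ 1} := by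
  apply le_antisymm <;> rw [Submodule.span_le] <;> rintro _ (rfl | rfl) <;>
    simp only [SetLike.mem_coe, Submodule.mem_span_pair]
  · exact ⟨A, 0, by simp [rescale]⟩
  · exact ⟨C, B, by simp [rescale]⟩
  · exact ⟨A⁻¹, 0, by simp [rescale, smul_smul, hA]⟩
  · refine ⟨-(C * A⁻¹ * B⁻¹), B⁻¹, ?_⟩
    simp [rescale, smul_smul, hB, smul_add, ← add_assoc, ← add_smul, ← neg_mul]
    left
    field_simp
    ring

theorem span_singleton_rescale (hA : A ≠ 0) :
    Submodule.span ℝ {rescale A B C θ 0} = Submodule.span ℝ {θ 0} :=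
  Submodule.span_singleton_smul_eq hA.isUnit _

/-- The shear fixes `X 2` and `X 3` and preserves the four values already normalized. The remaining
equations are triangular: those for β₂ determine t and u, and then β₁ on the new `X 1`, `X 0` is
affine in s with slope 1. -/
theorem isNormalizedFrame_shear {β₁ β₂ : V [⋀^Fin 2]→L[ℝ] ℝ} (h21 : β₁ ![X 2, X 1] = 1)
    (h31 : β₁ ![X 3, X 1] = 0) (h23 : β₁ ![X 2, X 3] = 0) (k23 : β₂ ![X 2, X 3] = 1)
    (ht : t = -β₂ ![X 3, X 1]) (hu : u = β₂ ![X 2, X 1])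
    (hs : s = t * β₁ ![X 2, X 0] + u * β₁ ![X 3, X 0] - β₁ ![X 1, X 0]) :
    IsNormalizedFrame (shearFrame s t u X) β₁ β₂ := by
  have h12 : β₁ ![X 1, X 2] = -1 := by rw [twoForm_swap, h21]
  have h13 : β₁ ![X 1, X 3] = 0 := by rw [twoForm_swap, h31, neg_zero]
  have h32 : β₁ ![X 3, X 2] = 0 := by rw [twoForm_swap, h23, neg_zero]
  have k32 : β₂ ![X 3, X 2] = -1 := by rw [twoForm_swap, k23]
  constructor <;>
    simp [shearFrame, twoForm_sub_right, twoForm_smul_left, twoForm_smul_right,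
      twoForm_self, h21, h31, h23, k23, h12, h13, h32, k32] <;> linarith

end ChangeOfCoframe


theorem compContinuousLinearMap_one {V W : Type*} [AddCommGroup V] [Module ℝ V]
    [TopologicalSpace V] [AddCommGroup W] [Module ℝ W] [TopologicalSpace W]
    (α : V [⋀^Fin 1]→L[ℝ] ℝ) (A : W →L[ℝ] V) (u : W) :
    α.compContinuousLinearMap A ![u] = α ![A u] := by
  rw [ContinuousAlternatingMap.compContinuousLinearMap_apply]
  congr 1
  ext k
  fin_cases k
  rfl

theorem compContinuousLinearMap_two {V W : Type*} [AddCommGroup V] [Module ℝ V]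
    [TopologicalSpace V] [AddCommGroup W] [Module ℝ W] [TopologicalSpace W]
    (β : V [⋀^Fin 2]→L[ℝ] ℝ) (A : W →L[ℝ] V) (u v : W) :
    β.compContinuousLinearMap A ![u, v] = β ![A u, A v] := by
  rw [ContinuousAlternatingMap.compContinuousLinearMap_apply]
  congr 1
  ext k
  fin_cases k <;> rfl

/-! ### Locality, the Leibniz rule and smoothness of coefficients. -/

section SmoothFrames

variable {M : Type*} [TopologicalSpace M] [ChartedSpace E4 M]

theorem Form.inChart_congr {k : ℕ} {θ η : Form M k} {x : M} (h : ∀ᶠ y in 𝓝 x, θ y = η y) :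
    θ.inChart x =ᶠ[𝓝 (extChartAt (𝓡 4) x x)] η.inChart x := by
  filter_upwards [(tendsto_extChartAt_symm x).eventually h] with y hy
  unfold Form.inChart
  rw [hy]

theorem Form.SmoothAt.congr {k : ℕ} {θ η : Form M k} {x : M} (hθ : θ.SmoothAt x)
    (h : ∀ᶠ y in 𝓝 x, η y = θ y) : η.SmoothAt x :=
  ContDiffAt.congr_of_eventuallyEq hθ (Form.inChart_congr h)

theorem Form.d_congr {k : ℕ} {θ η : Form M k} {x : M} (h : ∀ᶠ y in 𝓝 x, θ y = η y) :
    θ.d x = η.d x := by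
  unfold Form.d
  rw [(Form.inChart_congr h).extDeriv_eq]

theorem contDiffAt_comp_extChartAt_symm {g : M → ℝ} {x : M}
    (hg : ContMDiffAt (𝓡 4) 𝓘(ℝ, ℝ) ∞ g x) :
    ContDiffAt ℝ ∞ (g ∘ (extChartAt (𝓡 4) x).symm) (extChartAt (𝓡 4) x x) := by
  have := contMDiffAt_iff_source.1 hg
  simpa [contMDiffWithinAt_iff_contDiffWithinAt, contDiffWithinAt_univ] using this

theorem contMDiffAt_of_comp_extChartAt_symm {g : M → ℝ} {x : M}
    (hg : ContDiffAt ℝ ∞ (g ∘ (extChartAt (𝓡 4) x).symm) (extChartAt (𝓡 4) x x)) :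
    ContMDiffAt (𝓡 4) 𝓘(ℝ, ℝ) ∞ g x := by
  refine contMDiffAt_iff_source.2 ?_
  simpa [contMDiffWithinAt_iff_contDiffWithinAt, contDiffWithinAt_univ] using hg

theorem Form.SmoothAt.fun_smul {k : ℕ} {g : M → ℝ} {θ : Form M k} {x : M}
    (hg : ContMDiffAt (𝓡 4) 𝓘(ℝ, ℝ) ∞ g x) (hθ : θ.SmoothAt x) :
    Form.SmoothAt (fun y => g y • θ y : Form M k) x :=
  (contDiffAt_comp_extChartAt_symm hg).smul hθ

theorem Form.inChart_self [IsManifold (𝓡 4) ∞ M] {k : ℕ} (θ : Form M k) (x : M) :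
    θ.inChart x (extChartAt (𝓡 4) x x) = θ x := by
  have : IsManifold (𝓡 4) 1 M := .of_le (n := ∞) (by simp)
  have key : ∀ (p q : M) (_ : p = q) (A : E4 →L[ℝ] E4),
      (θ p).compContinuousLinearMap A = (θ q).compContinuousLinearMap A := by
    rintro p _ rfl A; rfl
  have h2 := mfderivWithin_range_extChartAt_symm (I := 𝓡 4) (x := x)
  rw [ModelWithCorners.Boundaryless.range_eq_univ, mfderivWithin_univ] at h2
  refine (key _ _ (extChartAt_to_inv x) _).trans ?_
  refine (congrArg (fun A : E4 →L[ℝ] E4 => (θ x).compContinuousLinearMap A) h2).trans ?_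
  ext v
  rfl

/-- The Leibniz rule `d (gθ) = dg ∧ θ + g dθ`. -/
theorem Form.exists_d_fun_smul [IsManifold (𝓡 4) ∞ M] {g : M → ℝ} {x : M}
    (hg : ContMDiffAt (𝓡 4) 𝓘(ℝ, ℝ) ∞ g x) :
    ∃ η : TangentSpace (𝓡 4) x [⋀^Fin 1]→L[ℝ] ℝ, ∀ θ : Form M 1, θ.SmoothAt x →
      Form.d (fun y => g y • θ y : Form M 1) x = wedge η (θ x) + g x • θ.d x := by
  have hg' := (contDiffAt_comp_extChartAt_symm hg).differentiableAt (by simp)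
  set γ : E4 → ℝ := g ∘ (extChartAt (𝓡 4) x).symm with hγ
  set z : E4 := extChartAt (𝓡 4) x x with hz
  let η : E4 [⋀^Fin 1]→L[ℝ] ℝ :=
    ContinuousAlternatingMap.ofSubsingleton ℝ E4 ℝ (0 : Fin 1) (fderiv ℝ γ z)
  refine ⟨η, fun θ hθ => ?_⟩
  have hθ' := hθ.differentiableAt (by simp)
  have hηv (v : E4) : η ![v] = fderiv ℝ γ z v := rfl
  have key (α : E4 → E4 [⋀^Fin 1]→L[ℝ] ℝ) (hα : DifferentiableAt ℝ α z) :
      extDeriv (fun y => γ y • α y) z = wedge η (α z) + γ z • extDeriv α z := by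
    refine twoForm_ext fun u v => ?_
    rw [extDeriv_oneForm_apply, fderiv_fun_smul hg' hα, ContinuousAlternatingMap.add_apply,
      ContinuousAlternatingMap.smul_apply, extDeriv_oneForm_apply]
    erw [wedge_oneForm_apply]
    simp [hηv]
    ring
  have hgx : γ z = g x := congrArg g (extChartAt_to_inv x)
  have hθx := Form.inChart_self θ x
  rw [Form.d_eq, Form.d_eq θ]
  refine (key (θ.inChart x) hθ').trans ?_
  rw [hgx]
  exact congrArg (fun α : E4 [⋀^Fin 1]→L[ℝ] ℝ => wedge η α + g x • extDeriv (θ.inChart x) z) hθx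

theorem Form.SmoothAt.fun_add {k : ℕ} {θ η : Form M k} {x : M} (hθ : θ.SmoothAt x)
    (hη : η.SmoothAt x) : Form.SmoothAt (fun y => θ y + η y : Form M k) x := hθ.add hη

theorem finrank_tangentSpace (x : M) : Module.finrank ℝ (TangentSpace (𝓡 4) x) = 4 :=
  finrank_euclideanSpace_fin (𝕜 := ℝ) (n := 4)

variable [IsManifold (𝓡 4) ∞ M]

/-- The frame dual to a smooth coframe is smooth. -/
theorem exists_smooth_dualFrame {θ : Fin 4 → Form M 1} {X : (x : M) → Fin 4 → TangentSpace (𝓡 4) x}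
    {x : M} (hθ : ∀ i, (θ i).SmoothAt x)
    (hX : ∀ᶠ y in 𝓝 x, IsDualFrame (fun i => θ i y) (X y)) :
    ∃ Y : Fin 4 → E4 → E4, (∀ j, ContDiffAt ℝ ∞ (Y j) (extChartAt (𝓡 4) x x)) ∧
      ∀ᶠ y in 𝓝 (extChartAt (𝓡 4) x x), ∀ j,
        mfderiv (𝓡 4) (𝓡 4) (extChartAt (𝓡 4) x).symm y (Y j y) =
          X ((extChartAt (𝓡 4) x).symm y) j := by
  let ℓ (i : Fin 4) (y : E4) : E4 →L[ℝ] ℝ :=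
    (ContinuousAlternatingMap.ofSubsingletonLIE (𝕜 := ℝ) (E := E4) (F := ℝ) (0 : Fin 1)).symm
      ((θ i).inChart x y)
  have hℓ (i : Fin 4) (y v : E4) : ℓ i y v = (θ i).inChart x y ![v] := by
    show (θ i).inChart x y _ = _
    congr 1
    ext i
    fin_cases i
    rfl
  -- In the chart the coframe is a smooth family of linear maps to ℝ⁴, invertible at the centre and
  -- so nearby; the dual frame is the inverse applied to the standard basis, and inversion is
  -- smooth.
  let L (y : E4) : E4 →L[ℝ] (Fin 4 → ℝ) :=
    ∑ i, (ContinuousLinearMap.toSpanSingleton ℝ (Pi.single i 1 : Fin 4 → ℝ)) ∘L ℓ i y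
  have hLapply (y v : E4) (i : Fin 4) : L y v i = (θ i).inChart x y ![v] := by
    simp only [L, sum_apply, Finset.sum_apply,
      ContinuousLinearMap.comp_apply, ContinuousLinearMap.toSpanSingleton_apply, Pi.smul_apply,
      smul_eq_mul, hℓ, Pi.single_apply]
    simp
  have hL : ContDiffAt ℝ ∞ L (extChartAt (𝓡 4) x x) :=
    ContDiffAt.sum fun i _ => contDiffAt_const.clm_comp
      ((ContinuousAlternatingMap.ofSubsingletonLIE (𝕜 := ℝ) (E := E4) (F := ℝ)
        (0 : Fin 1)).symm.toContinuousLinearEquiv.contDiff.contDiffAt.comp _ (hθ i))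
  have hinj : Function.Injective (L (extChartAt (𝓡 4) x x)) := by
    refine (injective_iff_map_eq_zero _).2 fun v hv => ?_
    refine (hX.self_of_nhds.expand v).trans (Finset.sum_eq_zero fun i _ => ?_)
    have := congrFun hv i
    rw [hLapply, Form.inChart_self] at this
    rw [show θ i x ![v] = 0 from this]
    exact zero_smul ℝ _
  let e : E4 ≃L[ℝ] (Fin 4 → ℝ) := (LinearEquiv.ofInjectiveOfFinrankEq
    (L (extChartAt (𝓡 4) x x) : E4 →ₗ[ℝ] (Fin 4 → ℝ)) hinj (by simp)).toContinuousLinearEquiv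
  have he : (e : E4 →L[ℝ] (Fin 4 → ℝ)) = L (extChartAt (𝓡 4) x x) := by
    ext v
    rfl
  have hinv : ∀ᶠ y in 𝓝 (extChartAt (𝓡 4) x x), (L y).IsInvertible := by
    have := e.nhds
    rw [he] at this
    filter_upwards [hL.continuousAt.eventually this] with y hy
    exact hy
  have hinverse : ContDiffAt ℝ ∞ (fun y => (L y).inverse) (extChartAt (𝓡 4) x x) := by
    have := contDiffAt_map_inverse (n := ∞) e
    rw [he] at this
    exact this.comp _ hL
  refine ⟨fun j y => (L y).inverse (Pi.single j 1), fun j => hinverse.clm_apply contDiffAt_const,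
    ?_⟩
  filter_upwards [hinv, (tendsto_extChartAt_symm x).eventually hX] with y h1 h2 j
  refine (h2.expand _).trans ?_
  have h3 (i : Fin 4) : θ i ((extChartAt (𝓡 4) x).symm y)
      ![mfderiv (𝓡 4) (𝓡 4) (extChartAt (𝓡 4) x).symm y ((L y).inverse (Pi.single j 1))] =
        (Pi.single j 1 : Fin 4 → ℝ) i := by
    have := hLapply y ((L y).inverse (Pi.single j 1)) i
    rw [h1.self_apply_inverse] at this
    rw [this]
    exact (compContinuousLinearMap_one (θ i ((extChartAt (𝓡 4) x).symm y)) _ _).symm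
  simp only [h3]
  refine (Finset.sum_eq_single j (fun i _ hij => ?_) (by simp)).trans ?_
  · rw [Pi.single_eq_of_ne hij]
    exact zero_smul ℝ _
  · rw [Pi.single_eq_same]
    exact one_smul ℝ _

theorem contMDiffAt_oneForm_apply_dualFrame {θ : Fin 4 → Form M 1}
    {X : (x : M) → Fin 4 → TangentSpace (𝓡 4) x} {x : M} (hθ : ∀ i, (θ i).SmoothAt x)
    (hX : ∀ᶠ y in 𝓝 x, IsDualFrame (fun i => θ i y) (X y)) {η : Form M 1} (hη : η.SmoothAt x)
    (j : Fin 4) : ContMDiffAt (𝓡 4) 𝓘(ℝ, ℝ) ∞ (fun y => η y ![X y j]) x := by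
  obtain ⟨Y, hY, hYX⟩ := exists_smooth_dualFrame hθ hX
  refine contMDiffAt_of_comp_extChartAt_symm ((hη.oneForm_apply (hY j)).congr_of_eventuallyEq ?_)
  filter_upwards [hYX] with y hy
  rw [Function.comp, ← hy]
  exact (compContinuousLinearMap_one (η ((extChartAt (𝓡 4) x).symm y)) _ _).symm

theorem contMDiffAt_d_apply_dualFrame {θ : Fin 4 → Form M 1}
    {X : (x : M) → Fin 4 → TangentSpace (𝓡 4) x} {x : M} (hθ : ∀ i, (θ i).SmoothAt x)
    (hX : ∀ᶠ y in 𝓝 x, IsDualFrame (fun i => θ i y) (X y)) {η : Form M 1}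
    (hη : ∀ᶠ y in 𝓝 x, η.SmoothAt y) (i j : Fin 4) :
    ContMDiffAt (𝓡 4) 𝓘(ℝ, ℝ) ∞ (fun y => η.d y ![X y i, X y j]) x := by
  obtain ⟨Y, hY, hYX⟩ := exists_smooth_dualFrame hθ hX
  refine contMDiffAt_of_comp_extChartAt_symm
    ((hη.self_of_nhds.extDeriv_oneForm_apply (hY i) (hY j)).congr_of_eventuallyEq ?_)
  filter_upwards [hYX, Form.inChart_d hη] with y hy hd
  rw [← hd, Function.comp, ← hy, ← hy]
  exact (compContinuousLinearMap_two (η.d ((extChartAt (𝓡 4) x).symm y)) _ _ _).symm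

end SmoothFrames


/-! ### Existence, uniqueness and gluing of normalized coframings. -/

section Normalization

variable {M : Type*} [TopologicalSpace M] [ChartedSpace E4 M]
variable {Ω : Form M 2} {I : CotangentField M} {U W : Set M} {θ θ' : Fin 4 → Form M 1} {x : M}

theorem IsCoframing.exists_dualFrame (h : IsCoframing U θ) :
    ∃ X : (x : M) → Fin 4 → TangentSpace (𝓡 4) x,
      ∀ x ∈ U, IsDualFrame (fun i => θ i x) (X x) := by
  have (x : M) : ∃ X : Fin 4 → TangentSpace (𝓡 4) x, x ∈ U → IsDualFrame (fun i => θ i x) X := by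
    by_cases hx : x ∈ U
    · obtain ⟨X, hX⟩ := exists_isDualFrame (finrank_tangentSpace x) (h.linearIndependent x hx)
      exact ⟨X, fun _ => hX⟩
    · exact ⟨0, fun h => absurd h hx⟩
  choose X hX using this
  exact ⟨X, hX⟩

theorem IsZeroAdapted.mono (h : IsZeroAdapted Ω I U θ) (hW : W ⊆ U) : IsZeroAdapted Ω I W θ where
  coframing := ⟨fun x hx => h.coframing.smooth x (hW hx),
    fun x hx => h.coframing.linearIndependent x (hW hx)⟩
  symplectic_eq x hx := h.symplectic_eq x (hW hx)
  system_eq x hx := h.system_eq x (hW hx)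
  derived_eq x hx := h.derived_eq x (hW hx)

theorem IsNormalized.mono (h : IsNormalized Ω I U θ) (hW : W ⊆ U) : IsNormalized Ω I W θ where
  zeroAdapted := h.zeroAdapted.mono hW
  structure_eqs := by
    obtain ⟨a, b, c, e, f, hs, heq⟩ := h.structure_eqs
    exact ⟨a, b, c, e, f, fun g hg => (hs g hg).mono hW, fun x hx => heq x (hW hx)⟩

theorem IsNormalized.isNormalizedFrame (h : IsNormalized Ω I U θ) (hx : x ∈ U)
    {X : Fin 4 → TangentSpace (𝓡 4) x} (hX : IsDualFrame (fun i => θ i x) X) :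
    IsNormalizedFrame X ((θ 0).d x) ((θ 1).d x) := by
  obtain ⟨a, b, c, e, f, -, heq⟩ := h.structure_eqs
  exact StructureEqs.isNormalizedFrame hX (heq x hx)

theorem IsZeroAdapted.rescale (h : IsZeroAdapted Ω I U θ) {A B C : M → ℝ}
    (hA : ∀ x ∈ U, ContMDiffAt (𝓡 4) 𝓘(ℝ, ℝ) ∞ A x) (hB : ∀ x ∈ U, ContMDiffAt (𝓡 4) 𝓘(ℝ, ℝ) ∞ B x)
    (hC : ∀ x ∈ U, ContMDiffAt (𝓡 4) 𝓘(ℝ, ℝ) ∞ C x) (hA0 : ∀ x ∈ U, A x ≠ 0)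
    (hB0 : ∀ x ∈ U, B x ≠ 0) :
    IsZeroAdapted Ω I U fun i x => rescale (A x) (B x) (C x) (fun j => θ j x) i where
  coframing := by
    obtain ⟨X, hX⟩ := h.coframing.exists_dualFrame
    refine ⟨fun x hx i => ?_, fun x hx => ((hX x hx).rescale (finrank_tangentSpace x) (hA0 x hx)
      (hB0 x hx)).linearIndependent⟩
    have hs := h.coframing.smooth x hx
    have hA' := (hA x hx).inv₀ (hA0 x hx)
    have hB' := (hB x hx).inv₀ (hB0 x hx)
    have hE := (((hC x hx).mul hA').mul hB').neg
    fin_cases i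
    · exact (hs 0).fun_smul (hA x hx)
    · exact ((hs 0).fun_smul (hC x hx)).fun_add ((hs 1).fun_smul (hB x hx))
    · refine (((hs 2).fun_smul hA').fun_add ((hs 3).fun_smul hE)).congr
        (Filter.Eventually.of_forall fun y => ?_)
      exact (sub_eq_add_neg _ _).trans (congrArg _ (neg_smul _ _).symm)
    · exact (hs 3).fun_smul hB'
  symplectic_eq x hx := (h.symplectic_eq x hx).trans
    (wedge_rescale (θ := fun j => θ j x) (hA0 x hx) (hB0 x hx)).symm
  system_eq x hx := (h.system_eq x hx).trans
    (span_pair_rescale (θ := fun j => θ j x) (hA0 x hx) (hB0 x hx)).symm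
  derived_eq x hx := (h.derived_eq x hx).trans
    (span_singleton_rescale (θ := fun j => θ j x) (hA0 x hx)).symm

theorem IsZeroAdapted.shear (h : IsZeroAdapted Ω I U θ) {s t u : M → ℝ}
    (hs : ∀ x ∈ U, ContMDiffAt (𝓡 4) 𝓘(ℝ, ℝ) ∞ s x) (ht : ∀ x ∈ U, ContMDiffAt (𝓡 4) 𝓘(ℝ, ℝ) ∞ t x)
    (hu : ∀ x ∈ U, ContMDiffAt (𝓡 4) 𝓘(ℝ, ℝ) ∞ u x) :
    IsZeroAdapted Ω I U fun i x => shear (s x) (t x) (u x) (fun j => θ j x) i where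
  coframing := by
    obtain ⟨X, hX⟩ := h.coframing.exists_dualFrame
    refine ⟨fun x hx i => ?_,
      fun x hx => ((hX x hx).shear (finrank_tangentSpace x)).linearIndependent⟩
    have hθ := h.coframing.smooth x hx
    fin_cases i
    · exact hθ 0
    · exact hθ 1
    · exact ((hθ 2).fun_add ((hθ 0).fun_smul (hs x hx))).fun_add ((hθ 1).fun_smul (ht x hx))
    · exact ((hθ 3).fun_add ((hθ 0).fun_smul (ht x hx))).fun_add ((hθ 1).fun_smul (hu x hx))
  symplectic_eq x hx := (h.symplectic_eq x hx).trans (wedge_shear (θ := fun j => θ j x)).symm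
  system_eq x hx := h.system_eq x hx
  derived_eq x hx := h.derived_eq x hx

variable [IsManifold (𝓡 4) ∞ M]

theorem exists_d_smul {f : M → ℝ} {η α : Form M 1} (hf : ContMDiffAt (𝓡 4) 𝓘(ℝ, ℝ) ∞ f x)
    (hα : α.SmoothAt x) (h : ∀ᶠ y in 𝓝 x, η y = f y • α y) :
    ∃ ξ : TangentSpace (𝓡 4) x [⋀^Fin 1]→L[ℝ] ℝ, η.d x = wedge ξ (α x) + f x • α.d x := by
  obtain ⟨ξ, hξ⟩ := Form.exists_d_fun_smul hf
  exact ⟨ξ, (Form.d_congr (η := (fun y => f y • α y : Form M 1)) h).trans (hξ _ hα)⟩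

theorem exists_d_linear_combination {f g : M → ℝ} {η α β : Form M 1}
    (hf : ContMDiffAt (𝓡 4) 𝓘(ℝ, ℝ) ∞ f x) (hg : ContMDiffAt (𝓡 4) 𝓘(ℝ, ℝ) ∞ g x)
    (hα : α.SmoothAt x) (hβ : β.SmoothAt x) (h : ∀ᶠ y in 𝓝 x, η y = f y • α y + g y • β y) :
    ∃ ξ ζ : TangentSpace (𝓡 4) x [⋀^Fin 1]→L[ℝ] ℝ,
      η.d x = wedge ξ (α x) + f x • α.d x + (wedge ζ (β x) + g x • β.d x) := by
  obtain ⟨ξ, hξ⟩ := Form.exists_d_fun_smul hf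
  obtain ⟨ζ, hζ⟩ := Form.exists_d_fun_smul hg
  refine ⟨ξ, ζ, ?_⟩
  rw [Form.d_congr (η := (fun y => f y • α y : Form M 1) + (fun y => g y • β y : Form M 1)) h,
    Form.d_add (hα.fun_smul hf) (hβ.fun_smul hg), hξ _ hα, hζ _ hβ]

/-- Membership in I⁽¹⁾ supplies a section η of I through θ 0 x, not θ 0 itself, with dη ≡ 0 mod I at
x. Writing η = f θ 0 + g θ 1 with f = 1 and g = 0 at x, dη and dθ 0 agree there modulo θ 0, θ 1. -/
theorem IsZeroAdapted.d_zero_apply (h : IsZeroAdapted Ω I U θ) (hU : IsOpen U) (hx : x ∈ U)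
    {X : Fin 4 → TangentSpace (𝓡 4) x} (hX : IsDualFrame (fun i => θ i x) X) :
    (θ 0).d x ![X 2, X 3] = 0 := by
  obtain ⟨Y, hY⟩ := h.coframing.exists_dualFrame
  have hYX := hX.unique (hY x hx)
  have hUx := hU.mem_nhds hx
  have hd : θ 0 x ∈ derivedSystem I x := by
    rw [h.derived_eq x hx]
    exact Submodule.mem_span_singleton_self _
  obtain ⟨η, hη, hηx, hηd⟩ := hd
  have hYe : ∀ᶠ y in 𝓝 x, IsDualFrame (fun i => θ i y) (Y y) := by
    filter_upwards [hUx] with y hy using hY y hy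
  have hs (j : Fin 4) := contMDiffAt_oneForm_apply_dualFrame (h.coframing.smooth x hx) hYe
    hη.self_of_nhds.1 j
  obtain ⟨ξ, ζ, e⟩ := exists_d_linear_combination (η := η) (hs 0) (hs 1)
    (h.coframing.smooth x hx 0) (h.coframing.smooth x hx 1) (by
      filter_upwards [hη, hUx] with y hy hyU
      have hm := hy.2
      rw [h.system_eq y hyU] at hm
      obtain ⟨h2, h3⟩ := (hY y hyU).mem_span_pair_iff.1 hm
      conv_lhs => rw [(hY y hyU).oneForm_expand (η y)]
      simp [Fin.sum_univ_four, h2, h3])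
  rw [h.system_eq x hx] at hηd
  have h23 := hX.mem_idealTwo_iff.1 hηd
  rw [e, hηx, hYX] at h23
  have ha : ∀ i j, θ i x ![X j] = if i = j then 1 else 0 := hX.apply
  simpa [wedge_oneForm_apply, ha] using h23

/-- The structure functions are recovered as values of dθ 0, dθ 1 on the dual frame, hence are
smooth; a pointwise check is therefore enough, and they never have to be glued. -/
theorem IsNormalized.of_isNormalizedFrame (h : IsZeroAdapted Ω I U θ) (hU : IsOpen U)
    (hN : ∀ x ∈ U, ∀ X : Fin 4 → TangentSpace (𝓡 4) x, IsDualFrame (fun i => θ i x) X →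
      IsNormalizedFrame X ((θ 0).d x) ((θ 1).d x)) : IsNormalized Ω I U θ := by
  obtain ⟨X, hX⟩ := h.coframing.exists_dualFrame
  have hs (i : Fin 4) (j k : Fin 4) : ContMDiffOn (𝓡 4) 𝓘(ℝ, ℝ) ∞
      (fun y => (θ i).d y ![X y j, X y k]) U := fun x hx =>
    (contMDiffAt_d_apply_dualFrame (h.coframing.smooth x hx)
      (by filter_upwards [hU.mem_nhds hx] with y hy using hX y hy)
      (by filter_upwards [hU.mem_nhds hx] with y hy using h.coframing.smooth y hy i)
      j k).contMDiffWithinAt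
  refine ⟨h, fun y => (θ 0).d y ![X y 2, X y 0], fun y => (θ 0).d y ![X y 3, X y 0],
    fun y => (θ 1).d y ![X y 1, X y 0], fun y => (θ 1).d y ![X y 2, X y 0],
    fun y => (θ 1).d y ![X y 3, X y 0], ?_, fun x hx => ?_⟩
  · intro g hg
    simp only [Set.mem_insert_iff, Set.mem_singleton_iff] at hg
    obtain rfl | rfl | rfl | rfl | rfl := hg
    exacts [hs 0 2 0, hs 0 3 0, hs 1 1 0, hs 1 2 0, hs 1 3 0]
  · obtain ⟨h1, h2⟩ := IsNormalizedFrame.structureEqs (θ := fun i => θ i x) (hX x hx)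
      (hN x hx (X x) (hX x hx))
    exact ⟨h1, h2⟩

/-- Normalized coframings are unique. -/
theorem IsNormalized.unique (h : IsNormalized Ω I U θ) (h' : IsNormalized Ω I U θ')
    (hU : IsOpen U) (hx : x ∈ U) : (fun i => θ' i x) = fun i => θ i x := by
  obtain ⟨X, hX⟩ := h.zeroAdapted.coframing.exists_dualFrame
  obtain ⟨a, b, c, e, f, -, heq⟩ := h'.structure_eqs
  have hΩ (y : M) (hy : y ∈ U) := (h'.zeroAdapted.symplectic_eq y hy).symm.trans
    (h.zeroAdapted.symplectic_eq y hy)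
  -- Equality is needed on all of `U`, not just at `x`: only then do the exterior derivatives at `x`
  -- agree, as the shear step requires.
  have h01 (y : M) (hy : y ∈ U) : θ' 0 y = θ 0 y ∧ θ' 1 y = θ 1 y := by
    have hUy := hU.mem_nhds hy
    have hXe : ∀ᶠ z in 𝓝 y, IsDualFrame (fun i => θ i z) (X z) := by
      filter_upwards [hUy] with z hz using hX z hz
    have hs (i j : Fin 4) := contMDiffAt_oneForm_apply_dualFrame
      (h.zeroAdapted.coframing.smooth y hy) hXe (h'.zeroAdapted.coframing.smooth y hy i) j
    have hsm := h.zeroAdapted.coframing.smooth y hy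
    have e0 (z : M) (hz : z ∈ U) : θ' 0 z = (θ' 0 z ![X z 0]) • θ 0 z := by
      have hm : θ' 0 z ∈ Submodule.span ℝ {θ 0 z} := by
        rw [← h.zeroAdapted.derived_eq z hz, h'.zeroAdapted.derived_eq z hz]
        exact Submodule.mem_span_singleton_self _
      obtain ⟨k1, k2, k3⟩ := (hX z hz).mem_span_singleton_iff.1 hm
      conv_lhs => rw [(hX z hz).oneForm_expand (θ' 0 z)]
      simp [Fin.sum_univ_four, k1, k2, k3]
    have e1 (z : M) (hz : z ∈ U) :
        θ' 1 z = (θ' 1 z ![X z 0]) • θ 0 z + (θ' 1 z ![X z 1]) • θ 1 z := by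
      have hm : θ' 1 z ∈ Submodule.span ℝ {θ 0 z, θ 1 z} := by
        rw [← h.zeroAdapted.system_eq z hz, h'.zeroAdapted.system_eq z hz]
        exact Submodule.subset_span (by simp)
      obtain ⟨k2, k3⟩ := (hX z hz).mem_span_pair_iff.1 hm
      conv_lhs => rw [(hX z hz).oneForm_expand (θ' 1 z)]
      simp [Fin.sum_univ_four, k2, k3]
    obtain ⟨ξ, d0⟩ := exists_d_smul (η := θ' 0) (hs 0 0) (hsm 0) (by
        filter_upwards [hUy] with z hz using e0 z hz)
    obtain ⟨ξ', ζ', d1⟩ := exists_d_linear_combination (η := θ' 1) (hs 1 0) (hs 1 1)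
      (hsm 0) (hsm 1) (by
        filter_upwards [hUy] with z hz
        exact e1 z hz)
    have ha : ∀ i j, θ i y ![X y j] = if i = j then 1 else 0 := (hX y hy).apply
    refine StructureEqs.rescaling_eq_one (θ := fun i => θ i y) (θ' := fun i => θ' i y) (hX y hy)
      (h.isNormalizedFrame hy (hX y hy)) (heq y hy) (hΩ y hy) (e0 y hy) (e1 y hy) ?_ ?_ ?_
    · rw [d0]
      simp [wedge_oneForm_apply, ha]
    · rw [d0]
      simp [wedge_oneForm_apply, ha]
    · rw [d1]
      simp [wedge_oneForm_apply, ha, add_comm]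
  have hd (i : Fin 4) (hi : ∀ y ∈ U, θ' i y = θ i y) : (θ' i).d x = (θ i).d x :=
    Form.d_congr (by filter_upwards [hU.mem_nhds hx] with y hy using hi y hy)
  have hst := heq x hx
  rw [hd 0 fun y hy => (h01 y hy).1, hd 1 fun y hy => (h01 y hy).2] at hst
  exact StructureEqs.shear_eq_zero (θ := fun i => θ i x) (θ' := fun i => θ' i x) (hX x hx)
    (h.isNormalizedFrame hx (hX x hx)) hst (hΩ x hx) (h01 x hx).1 (h01 x hx).2

/-- The real fifth root, on nonzero numbers. -/
def fifthRoot (r : ℝ) : ℝ := r * (r ^ 2) ^ (-(2 / 5) : ℝ)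

/-- The fifth power is r⁵ (r²)⁻² = r. Taking the real power of r² > 0 covers negative r and keeps
the root smooth away from 0. -/
theorem fifthRoot_pow {r : ℝ} (hr : r ≠ 0) : fifthRoot r ^ 5 = r := by
  have h2 : 0 < r ^ 2 := by positivity
  unfold fifthRoot
  rw [mul_pow, ← Real.rpow_natCast, ← Real.rpow_natCast ((r ^ 2) ^ (-(2 / 5) : ℝ)),
    ← Real.rpow_mul h2.le]
  norm_num
  field_simp

theorem contDiffAt_fifthRoot {r : ℝ} (hr : r ≠ 0) : ContDiffAt ℝ ∞ fifthRoot r :=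
  contDiffAt_id.mul ((contDiffAt_id.pow 2).rpow_const_of_ne (by simpa using hr))

/-- A 0-adapted coframing for which `dθ₁ = θ₃ ∧ θ₂` and `dθ₂ = θ₃ ∧ θ₄` modulo terms which the
choice of `θ₃, θ₄` can absorb. -/
theorem IsZeroAdapted.exists_isNormalized_of_d_apply (h : IsZeroAdapted Ω I U θ) (hU : IsOpen U)
    (hd : ∀ x ∈ U, ∀ X : Fin 4 → TangentSpace (𝓡 4) x, IsDualFrame (fun i => θ i x) X →
      (θ 0).d x ![X 2, X 1] = 1 ∧ (θ 0).d x ![X 3, X 1] = 0 ∧ (θ 1).d x ![X 2, X 3] = 1) :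
    ∃ θ', IsNormalized Ω I U θ' := by
  obtain ⟨X, hX⟩ := h.coframing.exists_dualFrame
  have hs (i j k : Fin 4) (x : M) (hx : x ∈ U) : ContMDiffAt (𝓡 4) 𝓘(ℝ, ℝ) ∞
      (fun y => (θ i).d y ![X y j, X y k]) x :=
    contMDiffAt_d_apply_dualFrame (h.coframing.smooth x hx)
      (by filter_upwards [hU.mem_nhds hx] with y hy using hX y hy)
      (by filter_upwards [hU.mem_nhds hx] with y hy using h.coframing.smooth y hy i) j k
  -- The solution of the triangular system in `isNormalizedFrame_shear`.
  let t : M → ℝ := fun x => -(θ 1).d x ![X x 3, X x 1]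
  let u : M → ℝ := fun x => (θ 1).d x ![X x 2, X x 1]
  let s : M → ℝ := fun x => t x * (θ 0).d x ![X x 2, X x 0] + u x * (θ 0).d x ![X x 3, X x 0] -
    (θ 0).d x ![X x 1, X x 0]
  have ht (x : M) (hx : x ∈ U) : ContMDiffAt (𝓡 4) 𝓘(ℝ, ℝ) ∞ t x := (hs 1 3 1 x hx).neg
  have hu (x : M) (hx : x ∈ U) : ContMDiffAt (𝓡 4) 𝓘(ℝ, ℝ) ∞ u x := hs 1 2 1 x hx
  have hs' (x : M) (hx : x ∈ U) : ContMDiffAt (𝓡 4) 𝓘(ℝ, ℝ) ∞ s x :=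
    (((ht x hx).mul (hs 0 2 0 x hx)).add ((hu x hx).mul (hs 0 3 0 x hx))).sub (hs 0 1 0 x hx)
  refine ⟨_, IsNormalized.of_isNormalizedFrame (h.shear hs' ht hu) hU fun x hx Y hY => ?_⟩
  have hYX := ((hX x hx).shear (s := s x) (t := t x) (u := u x)
    (finrank_tangentSpace x)).unique hY
  obtain ⟨h21, h31, k23⟩ := hd x hx (X x) (hX x hx)
  rw [hYX]
  exact isNormalizedFrame_shear h21 h31 (h.d_zero_apply hU hx (hX x hx)) k23 rfl rfl rfl

theorem IsOneAdapted.exists_isNormalized (h : IsOneAdapted Ω I U θ) (hU : IsOpen U)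
    (hp : ∀ x ∈ U, ∀ X : Fin 4 → TangentSpace (𝓡 4) x, IsDualFrame (fun i => θ i x) X →
      (θ 0).d x ![X 2, X 1] ≠ 0) : ∃ θ', IsNormalized Ω I U θ' := by
  have h0 := h.zeroAdapted
  obtain ⟨X, hX⟩ := h0.coframing.exists_dualFrame
  have hs (i j k : Fin 4) (x : M) (hx : x ∈ U) : ContMDiffAt (𝓡 4) 𝓘(ℝ, ℝ) ∞
      (fun y => (θ i).d y ![X y j, X y k]) x :=
    contMDiffAt_d_apply_dualFrame (h0.coframing.smooth x hx)
      (by filter_upwards [hU.mem_nhds hx] with y hy using hX y hy)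
      (by filter_upwards [hU.mem_nhds hx] with y hy using h0.coframing.smooth y hy i) j k
  let p : M → ℝ := fun x => (θ 0).d x ![X x 2, X x 1]
  have hp0 (x : M) (hx : x ∈ U) : p x ≠ 0 := hp x hx _ (hX x hx)
  -- Rescaling sends p to A² B⁻¹ p and the θ 2 ∧ θ 3 coefficient 1 of dθ 1 to A B², so A = B⁻² and
  -- B⁵ = p. With q the value of dθ 0 on (X 3, X 1), the new value is A B⁻¹ (B q + C p), which gives
  -- C = -q B / p.
  let B : M → ℝ := fun x => fifthRoot (p x)
  let A : M → ℝ := fun x => (B x * B x)⁻¹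
  let C : M → ℝ := fun x => -(θ 0).d x ![X x 3, X x 1] * B x * (p x)⁻¹
  have hB5 (x : M) (hx : x ∈ U) : B x ^ 5 = p x := fifthRoot_pow (hp0 x hx)
  have hB0 (x : M) (hx : x ∈ U) : B x ≠ 0 := fun hB => by
    have := hB5 x hx
    rw [hB] at this
    exact hp0 x hx (by rw [← this]; norm_num)
  have hA0 (x : M) (hx : x ∈ U) : A x ≠ 0 := inv_ne_zero (mul_ne_zero (hB0 x hx) (hB0 x hx))
  have hB (x : M) (hx : x ∈ U) : ContMDiffAt (𝓡 4) 𝓘(ℝ, ℝ) ∞ B x :=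
    (contDiffAt_fifthRoot (hp0 x hx)).contMDiffAt.comp x (hs 0 2 1 x hx)
  have hA (x : M) (hx : x ∈ U) : ContMDiffAt (𝓡 4) 𝓘(ℝ, ℝ) ∞ A x :=
    ((hB x hx).mul (hB x hx)).inv₀ (mul_ne_zero (hB0 x hx) (hB0 x hx))
  have hC (x : M) (hx : x ∈ U) : ContMDiffAt (𝓡 4) 𝓘(ℝ, ℝ) ∞ C x :=
    ((hs 0 3 1 x hx).neg.mul (hB x hx)).mul ((hs 0 2 1 x hx).inv₀ (hp0 x hx))
  refine (h0.rescale hA hB hC hA0 hB0).exists_isNormalized_of_d_apply hU fun x hx Y hY => ?_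
  have hYX := ((hX x hx).rescale (C := C x) (finrank_tangentSpace x) (hA0 x hx)
    (hB0 x hx)).unique hY
  have hsm := h0.coframing.smooth x hx
  obtain ⟨ξ, d0⟩ := exists_d_smul (hA x hx) (hsm 0) (Filter.Eventually.of_forall fun y =>
    (rfl : rescale (A y) (B y) (C y) (fun j => θ j y) 0 = A y • θ 0 y))
  obtain ⟨ζ, η, d1⟩ := exists_d_linear_combination (hC x hx) (hB x hx) (hsm 0) (hsm 1)
    (Filter.Eventually.of_forall fun y =>
    (rfl : rescale (A y) (B y) (C y) (fun j => θ j y) 1 = C y • θ 0 y + B y • θ 1 y))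
  have ha : ∀ i j, θ i x ![X x j] = if i = j then 1 else 0 := (hX x hx).apply
  have h23 := h0.d_zero_apply hU hx (hX x hx)
  have k23 : (θ 1).d x ![X x 2, X x 3] = 1 := by
    have := (hX x hx).mem_idealTwo_iff.1 (h.d_eq x hx)
    rw [ContinuousAlternatingMap.sub_apply, wedge_oneForm_apply, ha, ha, ha, ha] at this
    simp at this
    linarith
  have hpx : (θ 0).d x ![X x 2, X x 1] = B x ^ 5 := (hB5 x hx).symm
  have hCx : C x = -(θ 0).d x ![X x 3, X x 1] * B x * (B x ^ 5)⁻¹ := by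
    rw [hB5 x hx]
  have hAx : A x = (B x * B x)⁻¹ := rfl
  have hBx := hB0 x hx
  rw [d0, d1, hYX]
  refine ⟨?_, ?_, ?_⟩
  · simp [rescaleFrame, twoForm_smul_left, twoForm_smul_right, oneForm_smul, wedge_oneForm_apply,
      ha]
    rw [hpx, hAx]
    field_simp
  · simp [rescaleFrame, twoForm_smul_left, twoForm_smul_right, twoForm_add_left, oneForm_smul,
      oneForm_add, wedge_oneForm_apply, ha]
    right
    rw [hpx, hCx]
    field_simp
    ring
  · simp [rescaleFrame, twoForm_smul_left, twoForm_smul_right, twoForm_add_right, twoForm_self,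
      oneForm_smul, oneForm_add, wedge_oneForm_apply, ha, h23, k23]
    rw [hAx]
    field_simp

/-- Near a point of the generic domain there is a normalized coframing. -/
theorem exists_isNormalized_of_mem_genericDomain (hx : x ∈ genericDomain Ω I) :
    ∃ W, IsOpen W ∧ x ∈ W ∧ W ⊆ genericDomain Ω I ∧ ∃ θ, IsNormalized Ω I W θ := by
  obtain ⟨V, θ, hV, hxV, hθ, p, hp, hpx⟩ := hx
  have h0 := hθ.zeroAdapted
  obtain ⟨X, hX⟩ := h0.coframing.exists_dualFrame
  have hs (x : M) (hx : x ∈ V) : ContinuousAt (fun y => (θ 0).d y ![X y 2, X y 1]) x :=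
    (contMDiffAt_d_apply_dualFrame (h0.coframing.smooth x hx)
      (by filter_upwards [hV.mem_nhds hx] with y hy using hX y hy)
      (by filter_upwards [hV.mem_nhds hx] with y hy using h0.coframing.smooth y hy 0) 2 1).continuousAt
  have hiff (y : M) (hy : y ∈ V) (q : ℝ) : IsPThree Ω θ y q ↔ q = (θ 0).d y ![X y 2, X y 1] :=
    (hX y hy).isPThree_iff (h0.symplectic_eq y hy)
  -- The same 1-adapted coframing witnesses p₃ ≠ 0 at every point of this open set.
  let W : Set M := {y | y ∈ V ∧ (θ 0).d y ![X y 2, X y 1] ≠ 0}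
  have hWV : W ⊆ V := fun y hy => hy.1
  have hW : IsOpen W := by
    refine isOpen_iff_mem_nhds.2 fun y hy => ?_
    filter_upwards [hV.mem_nhds hy.1, (hs y hy.1).eventually_ne hy.2] with z hz hz'
    exact ⟨hz, hz'⟩
  refine ⟨W, hW, ⟨hxV, ?_⟩, fun y hy => ⟨V, θ, hV, hy.1, hθ, _, hy.2, (hiff y hy.1 _).2 rfl⟩, ?_⟩
  · rw [← (hiff x hxV p).1 hpx]
    exact hp
  · refine IsOneAdapted.exists_isNormalized (θ := θ) ⟨h0.mono hWV, fun y hy => hθ.d_eq y hy.1⟩ hW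
      fun y hy Y hY => ?_
    rw [(hX y hy.1).unique hY]
    exact hy.2

theorem isOpen_genericDomain : IsOpen (genericDomain Ω I) := by
  refine isOpen_iff_mem_nhds.2 fun x hx => ?_
  obtain ⟨W, hW, hxW, hWU, -⟩ := exists_isNormalized_of_mem_genericDomain hx
  exact Filter.mem_of_superset (hW.mem_nhds hxW) hWU

theorem exists_isNormalized : ∃ θ, IsNormalized Ω I (genericDomain Ω I) θ := by
  choose! W hW hxW hWU θ hθ using fun (x : M) (hx : x ∈ genericDomain Ω I) =>
    exists_isNormalized_of_mem_genericDomain hx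
  -- At each point, take the value of the coframing chosen for that point. By uniqueness on `W x ∩ W
  -- y`, it coincides on `W x` with the single smooth coframing `θ x`.
  let Θ : Fin 4 → Form M 1 := fun i x => θ x i x
  have hΘ {x : M} (hx : x ∈ genericDomain Ω I) {y : M} (hy : y ∈ W x) :
      (fun i => Θ i y) = fun i => θ x i y := by
    have hyU := hWU x hx hy
    exact IsNormalized.unique (θ' := θ y) ((hθ x hx).mono Set.inter_subset_left)
      ((hθ y hyU).mono Set.inter_subset_right) ((hW x hx).inter (hW y hyU)) ⟨hy, hxW y hyU⟩
  have hev {x : M} (hx : x ∈ genericDomain Ω I) (i : Fin 4) : ∀ᶠ y in 𝓝 x, Θ i y = θ x i y := by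
    filter_upwards [(hW x hx).mem_nhds (hxW x hx)] with y hy using congrFun (hΘ hx hy) i
  refine ⟨Θ, IsNormalized.of_isNormalizedFrame ⟨⟨fun x hx i => ?_, fun x hx => ?_⟩,
    fun x hx => ?_, fun x hx => ?_, fun x hx => ?_⟩ isOpen_genericDomain fun x hx X hX => ?_⟩
  · exact ((hθ x hx).zeroAdapted.coframing.smooth x (hxW x hx) i).congr (hev hx i)
  · exact (hθ x hx).zeroAdapted.coframing.linearIndependent x (hxW x hx)
  · exact (hθ x hx).zeroAdapted.symplectic_eq x (hxW x hx)
  · exact (hθ x hx).zeroAdapted.system_eq x (hxW x hx)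
  · exact (hθ x hx).zeroAdapted.derived_eq x (hxW x hx)
  · rw [Form.d_congr (hev hx 0), Form.d_congr (hev hx 1)]
    exact (hθ x hx).isNormalizedFrame (hxW x hx) hX

end Normalization


/-! ### Pointwise conditions under linear pullback. -/

section PullbackAlgebra

variable {V : Type*} [AddCommGroup V] [Module ℝ V] [TopologicalSpace V]
variable {W : Type*} [AddCommGroup W] [Module ℝ W] [TopologicalSpace W]

theorem compContinuousLinearMap_mem_idealTwo {J : Submodule ℝ (V [⋀^Fin 1]→L[ℝ] ℝ)}
    {β : V [⋀^Fin 2]→L[ℝ] ℝ} (hβ : β ∈ idealTwo J) (A : W →L[ℝ] V) :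
    β.compContinuousLinearMap A ∈
      idealTwo (J.map (ContinuousAlternatingMap.compContinuousLinearMapₗ A)) := by
  refine Submodule.span_induction (p := fun β _ => β.compContinuousLinearMap A ∈
    idealTwo (J.map (ContinuousAlternatingMap.compContinuousLinearMapₗ A))) ?_ ?_ ?_ ?_ hβ
  · rintro _ ⟨θ, hθ, η, rfl⟩
    refine Submodule.subset_span ⟨_, Submodule.mem_map_of_mem hθ, η.compContinuousLinearMap A, ?_⟩
    exact wedge_compContinuousLinearMap θ η A
  · exact Submodule.zero_mem _
  · intro α γ _ _ hα hγ
    exact Submodule.add_mem _ hα hγ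
  · intro c α _ hα
    exact Submodule.smul_mem _ c hα

theorem wedge_add_wedge_compContinuousLinearMap {k l : ℕ} (α γ : V [⋀^Fin k]→L[ℝ] ℝ)
    (β δ : V [⋀^Fin l]→L[ℝ] ℝ) (A : W →L[ℝ] V) :
    (wedge α β + wedge γ δ).compContinuousLinearMap A =
      wedge (α.compContinuousLinearMap A) (β.compContinuousLinearMap A) +
        wedge (γ.compContinuousLinearMap A) (δ.compContinuousLinearMap A) := by
  rw [← wedge_compContinuousLinearMap, ← wedge_compContinuousLinearMap]
  rfl

theorem sub_wedge_compContinuousLinearMap {k l : ℕ} (γ : V [⋀^Fin (k + l)]→L[ℝ] ℝ)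
    (α : V [⋀^Fin k]→L[ℝ] ℝ) (β : V [⋀^Fin l]→L[ℝ] ℝ) (A : W →L[ℝ] V) :
    (γ - wedge α β).compContinuousLinearMap A = γ.compContinuousLinearMap A -
      wedge (α.compContinuousLinearMap A) (β.compContinuousLinearMap A) := by
  rw [← wedge_compContinuousLinearMap]
  rfl

theorem StructureEqs.compContinuousLinearMap {θ : Fin 4 → V [⋀^Fin 1]→L[ℝ] ℝ}
    {β₁ β₂ : V [⋀^Fin 2]→L[ℝ] ℝ} {a b c e f : ℝ} (h : StructureEqs θ β₁ β₂ a b c e f)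
    (A : W →L[ℝ] V) :
    StructureEqs (fun i => (θ i).compContinuousLinearMap A) (β₁.compContinuousLinearMap A)
      (β₂.compContinuousLinearMap A) a b c e f := by
  obtain ⟨rfl, rfl⟩ := h
  constructor
  · erw [wedge_add_wedge_compContinuousLinearMap]
    rfl
  · erw [wedge_add_wedge_compContinuousLinearMap]
    rfl

theorem linearIndependent_compContinuousLinearMap {ι : Type*} {θ : ι → V [⋀^Fin 1]→L[ℝ] ℝ}
    (h : LinearIndependent ℝ θ) {A : W →L[ℝ] V} (hA : Function.Surjective A) :
    LinearIndependent ℝ fun i => (θ i).compContinuousLinearMap A := by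
  refine h.map' (ContinuousAlternatingMap.compContinuousLinearMapₗ A)
    (LinearMap.ker_eq_bot'.2 fun α hα => oneForm_ext fun v => ?_)
  obtain ⟨w, rfl⟩ := hA v
  rw [← compContinuousLinearMap_one]
  exact congrArg (fun β : W [⋀^Fin 1]→L[ℝ] ℝ => β ![w]) hα

theorem map_span_pair {α β : V [⋀^Fin 1]→L[ℝ] ℝ} (A : W →L[ℝ] V) :
    (Submodule.span ℝ {α, β}).map (ContinuousAlternatingMap.compContinuousLinearMapₗ A) =
      Submodule.span ℝ {α.compContinuousLinearMap A, β.compContinuousLinearMap A} := by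
  rw [Submodule.map_span, Set.image_pair]
  rfl

theorem map_span_singleton {α : V [⋀^Fin 1]→L[ℝ] ℝ} (A : W →L[ℝ] V) :
    (Submodule.span ℝ {α}).map (ContinuousAlternatingMap.compContinuousLinearMapₗ A) =
      Submodule.span ℝ {α.compContinuousLinearMap A} := by
  rw [Submodule.map_span, Set.image_singleton]
  rfl

theorem pThree_compContinuousLinearMap {α γ : V [⋀^Fin 1]→L[ℝ] ℝ} {β Ω : V [⋀^Fin 2]→L[ℝ] ℝ}
    {p : ℝ} (h : wedge (wedge α β) γ = (p / 2) • wedge Ω Ω) (A : W →L[ℝ] V) :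
    wedge (wedge (α.compContinuousLinearMap A) (β.compContinuousLinearMap A))
        (γ.compContinuousLinearMap A) =
      (p / 2) • wedge (Ω.compContinuousLinearMap A) (Ω.compContinuousLinearMap A) := by
  rw [← wedge_compContinuousLinearMap, ← wedge_compContinuousLinearMap,
    ← wedge_compContinuousLinearMap, h]
  rfl

end PullbackAlgebra

/-! ### Invariance under isomorphisms. -/

section Naturality

variable {M : Type*} [TopologicalSpace M] [ChartedSpace E4 M]
variable {N : Type*} [TopologicalSpace N] [ChartedSpace E4 N]
variable {Ω : Form M 2} {I : CotangentField M} {Ω' : Form N 2} {I' : CotangentField N}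
variable {φ : M ≃ₘ^∞⟮𝓡 4, 𝓡 4⟯ N}

theorem Form.pullback_pullback_symm {k : ℕ} (φ : M ≃ₘ^∞⟮𝓡 4, 𝓡 4⟯ N) (θ : Form M k) :
    (θ.pullback φ.symm).pullback φ = θ := by
  funext x
  rw [← Form.pullback_comp (φ.symm.contMDiff.contMDiffAt.mdifferentiableAt (by simp))
    (φ.contMDiff.contMDiffAt.mdifferentiableAt (by simp))]
  have : (φ.symm ∘ φ : M → M) = id := funext φ.symm_apply_apply
  rw [this, Form.pullback_id]

/-- Lets an inclusion proved for every isomorphism be applied to the inverse, so that derived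
systems need only be compared in one direction. -/
theorem le_map_pullback_of_symm {J : CotangentField M} {J' : CotangentField N}
    (h : ∀ y, (J (φ.symm y)).map (ContinuousAlternatingMap.compContinuousLinearMapₗ
      (mfderiv (𝓡 4) (𝓡 4) φ.symm y)) ≤ J' y) (x : M) :
    J x ≤ (J' (φ x)).map (ContinuousAlternatingMap.compContinuousLinearMapₗ
      (mfderiv (𝓡 4) (𝓡 4) φ x)) := by
  classical
  intro α hα
  -- Extending the covector by zero to a field, with no smoothness needed, makes the identity for
  -- pulling back forms there and back applicable.
  let a : Form M 1 := Function.update 0 x α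
  have hax : a x = α := Function.update_self ..
  have ha : ∀ z, z = x → a z ∈ J z := by
    rintro _ rfl
    rwa [hax]
  refine ⟨a.pullback φ.symm (φ x),
    h _ (Submodule.mem_map_of_mem (ha _ (φ.symm_apply_apply x))), ?_⟩
  rw [← hax]
  exact congrFun (Form.pullback_pullback_symm φ a) x

theorem map_pullback_symm_le {J : CotangentField M} {J' : CotangentField N}
    (h : ∀ x, J x ≤ (J' (φ x)).map (ContinuousAlternatingMap.compContinuousLinearMapₗ
      (mfderiv (𝓡 4) (𝓡 4) φ x))) (y : N) :
    (J (φ.symm y)).map (ContinuousAlternatingMap.compContinuousLinearMapₗ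
      (mfderiv (𝓡 4) (𝓡 4) φ.symm y)) ≤ J' y := by
  classical
  rintro _ ⟨β, hβ, rfl⟩
  obtain ⟨γ, hγ, rfl⟩ := h _ hβ
  let b : Form N 1 := Function.update 0 (φ (φ.symm y)) γ
  have hbγ : b (φ (φ.symm y)) = γ := Function.update_self ..
  have hb : ∀ z, z = φ (φ.symm y) → b z ∈ J' z := by
    rintro _ rfl
    rwa [hbγ]
  rw [← hbγ]
  have e : (b.pullback φ).pullback φ.symm y = b y :=
    congrFun (Form.pullback_pullback_symm φ.symm b) y
  have hy := hb y (φ.apply_symm_apply y).symm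
  rw [← e] at hy
  exact hy

theorem IsIsomorphism.symm (h : IsIsomorphism φ Ω I Ω' I') : IsIsomorphism φ.symm Ω' I' Ω I where
  pullback_symplectic y := by
    have : Ω'.pullback φ = Ω := funext h.pullback_symplectic
    rw [← this]
    exact congrFun (Form.pullback_pullback_symm φ.symm Ω') y
  pullback_system y :=
    le_antisymm (le_map_pullback_of_symm (φ := φ.symm) (fun x => (h.pullback_system x).ge) y)
      (map_pullback_symm_le (fun x => (h.pullback_system x).le) y)

theorem surjective_mfderiv (φ : M ≃ₘ^∞⟮𝓡 4, 𝓡 4⟯ N) (x : M) :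
    Function.Surjective (mfderiv (𝓡 4) (𝓡 4) φ x) :=
  (φ.mfderivToContinuousLinearEquiv (by simp) x).surjective

variable [IsManifold (𝓡 4) ∞ M] [IsManifold (𝓡 4) ∞ N]

/-- A local section witnessing membership pulls back to one, since pullback commutes with d and
carries the ideal of I' into that of I. -/
theorem IsIsomorphism.map_derivedSystem_le (h : IsIsomorphism φ Ω I Ω' I') (x : M) :
    (derivedSystem I' (φ x)).map
      (ContinuousAlternatingMap.compContinuousLinearMapₗ (mfderiv (𝓡 4) (𝓡 4) φ x)) ≤
        derivedSystem I x := by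
  rintro _ ⟨_, ⟨θ, hθ, rfl, hd⟩, rfl⟩
  refine ⟨θ.pullback φ, ?_, rfl, ?_⟩
  · filter_upwards [φ.continuous.continuousAt.eventually hθ] with y hy
    refine ⟨hy.1.pullback φ.contMDiff.contMDiffAt, ?_⟩
    rw [h.pullback_system y]
    exact Submodule.mem_map_of_mem hy.2
  · rw [Form.d_pullback φ.contMDiff.contMDiffAt hθ.self_of_nhds.1, h.pullback_system x]
    exact compContinuousLinearMap_mem_idealTwo hd _

theorem IsIsomorphism.derivedSystem_eq (h : IsIsomorphism φ Ω I Ω' I') (x : M) :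
    derivedSystem I x = (derivedSystem I' (φ x)).map
      (ContinuousAlternatingMap.compContinuousLinearMapₗ (mfderiv (𝓡 4) (𝓡 4) φ x)) :=
  le_antisymm (le_map_pullback_of_symm h.symm.map_derivedSystem_le x)
    (h.map_derivedSystem_le x)

theorem IsIsomorphism.isZeroAdapted_pullback (h : IsIsomorphism φ Ω I Ω' I') {U : Set N}
    {θ : Fin 4 → Form N 1} (hθ : IsZeroAdapted Ω' I' U θ) :
    IsZeroAdapted Ω I (φ ⁻¹' U) fun i => (θ i).pullback φ where
  coframing := ⟨fun x hx i => (hθ.coframing.smooth _ hx i).pullback φ.contMDiff.contMDiffAt,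
    fun x hx => linearIndependent_compContinuousLinearMap
      (hθ.coframing.linearIndependent _ hx) (surjective_mfderiv φ x)⟩
  symplectic_eq x hx := by
    rw [← h.pullback_symplectic x]
    unfold Form.pullback
    rw [hθ.symplectic_eq _ hx]
    exact wedge_add_wedge_compContinuousLinearMap _ _ _ _ _
  system_eq x hx := by
    rw [h.pullback_system x, hθ.system_eq _ hx]
    exact map_span_pair _
  derived_eq x hx := by
    rw [h.derivedSystem_eq x, hθ.derived_eq _ hx]
    exact map_span_singleton _

theorem IsIsomorphism.isOneAdapted_pullback (h : IsIsomorphism φ Ω I Ω' I') {U : Set N}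
    {θ : Fin 4 → Form N 1} (hθ : IsOneAdapted Ω' I' U θ) :
    IsOneAdapted Ω I (φ ⁻¹' U) fun i => (θ i).pullback φ where
  zeroAdapted := h.isZeroAdapted_pullback hθ.zeroAdapted
  d_eq x hx := by
    rw [Form.d_pullback φ.contMDiff.contMDiffAt (hθ.zeroAdapted.coframing.smooth _ hx 1)]
    have := compContinuousLinearMap_mem_idealTwo (hθ.d_eq _ hx) (mfderiv (𝓡 4) (𝓡 4) φ x)
    rw [map_span_pair] at this
    refine Eq.mp (congrArg (· ∈ _) ?_) this
    exact sub_wedge_compContinuousLinearMap _ _ _ _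

theorem IsIsomorphism.isNormalized_pullback (h : IsIsomorphism φ Ω I Ω' I') {U : Set N}
    {θ : Fin 4 → Form N 1} (hθ : IsNormalized Ω' I' U θ) :
    IsNormalized Ω I (φ ⁻¹' U) fun i => (θ i).pullback φ where
  zeroAdapted := h.isZeroAdapted_pullback hθ.zeroAdapted
  structure_eqs := by
    obtain ⟨a, b, c, e, f, hs, heq⟩ := hθ.structure_eqs
    have hs' (g : N → ℝ) (hg : g ∈ ({a, b, c, e, f} : Set (N → ℝ))) :
        ContMDiffOn (𝓡 4) 𝓘(ℝ, ℝ) ∞ (g ∘ φ) (φ ⁻¹' U) :=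
      (hs g hg).comp φ.contMDiff.contMDiffOn subset_rfl
    refine ⟨a ∘ φ, b ∘ φ, c ∘ φ, e ∘ φ, f ∘ φ, ?_, fun x hx => ?_⟩
    · intro g hg
      simp only [Set.mem_insert_iff, Set.mem_singleton_iff] at hg
      obtain rfl | rfl | rfl | rfl | rfl := hg <;> exact hs' _ (by simp)
    · have hsm := hθ.zeroAdapted.coframing.smooth _ hx
      have hst : StructureEqs (fun i => θ i (φ x)) ((θ 0).d (φ x)) ((θ 1).d (φ x)) (a (φ x))
        (b (φ x)) (c (φ x)) (e (φ x)) (f (φ x)) := heq _ hx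
      obtain ⟨h0, h1⟩ := hst.compContinuousLinearMap (mfderiv (𝓡 4) (𝓡 4) φ x)
      rw [Form.d_pullback φ.contMDiff.contMDiffAt (hsm 0),
        Form.d_pullback φ.contMDiff.contMDiffAt (hsm 1)]
      exact ⟨h0, h1⟩

theorem IsIsomorphism.preimage_genericDomain_subset (h : IsIsomorphism φ Ω I Ω' I') :
    φ ⁻¹' genericDomain Ω' I' ⊆ genericDomain Ω I := by
  rintro x ⟨V, θ, hV, hxV, hθ, p, hp, hpx⟩
  refine ⟨φ ⁻¹' V, _, hV.preimage φ.continuous, hxV, h.isOneAdapted_pullback hθ, p, hp, ?_⟩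
  unfold IsPThree
  rw [Form.d_pullback φ.contMDiff.contMDiffAt (hθ.zeroAdapted.coframing.smooth _ hxV 0),
    ← h.pullback_symplectic x]
  exact pThree_compContinuousLinearMap hpx (mfderiv (𝓡 4) (𝓡 4) φ x)

theorem IsIsomorphism.preimage_genericDomain (h : IsIsomorphism φ Ω I Ω' I') :
    φ ⁻¹' genericDomain Ω' I' = genericDomain Ω I := by
  refine h.preimage_genericDomain_subset.antisymm fun x hx => h.symm.preimage_genericDomain_subset ?_
  simpa using hx

end Naturality

end

end LagrangianEngel

/-! ### The canonical e-structure. -/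

theorem mainTheorem3 {M : Type*} [TopologicalSpace M] [ChartedSpace E4 M]
    [IsManifold (𝓡 4) ∞ M] (Ω : Form M 2) (I : CotangentField M)
    (h : IsLagrangianEngel Ω I) :
    IsOpen (genericDomain Ω I) ∧
    (∃ θ : Fin 4 → Form M 1, IsNormalized Ω I (genericDomain Ω I) θ ∧
      ∀ W : Set M, IsOpen W → W ⊆ genericDomain Ω I →
        ∀ θ' : Fin 4 → Form M 1, IsNormalized Ω I W θ' → ∀ x ∈ W, ∀ i, θ' i x = θ i x) ∧
    (∀ {N : Type*} [TopologicalSpace N] [ChartedSpace E4 N] [IsManifold (𝓡 4) ∞ N]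
      (Ω' : Form N 2) (I' : CotangentField N), IsLagrangianEngel Ω' I' →
      ∀ φ : M ≃ₘ^∞⟮𝓡 4, 𝓡 4⟯ N, IsIsomorphism φ Ω I Ω' I' →
        φ ⁻¹' genericDomain Ω' I' = genericDomain Ω I ∧
        ∀ (θ : Fin 4 → Form M 1) (θ' : Fin 4 → Form N 1),
          IsNormalized Ω I (genericDomain Ω I) θ →
          IsNormalized Ω' I' (genericDomain Ω' I') θ' →
          ∀ x ∈ genericDomain Ω I, ∀ i, (θ' i).pullback φ x = θ i x) := by
  refine ⟨isOpen_genericDomain, ?_, ?_⟩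
  · obtain ⟨θ, hθ⟩ := exists_isNormalized (Ω := Ω) (I := I)
    exact ⟨θ, hθ, fun W hW hWU θ' hθ' x hx i =>
      congrFun ((hθ.mono hWU).unique hθ' hW hx) i⟩
  · intro N _ _ _ Ω' I' _ φ hφ
    refine ⟨hφ.preimage_genericDomain, fun θ θ' hθ hθ' x hx i => ?_⟩
    -- The pulled-back coframing is normalized on the same domain, so uniqueness identifies it with
    -- `θ`.
    have hp := hφ.isNormalized_pullback hθ'
    rw [hφ.preimage_genericDomain] at hp
    exact congrFun (hθ.unique hp isOpen_genericDomain hx) i
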